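/- Let $X$ be a complex Banach space, $L(X)$ the bounded linear operators on $X$, and $A:D(A)\to X$ the generator of a $C_0$-semigroup $(T(t))_{t\ge 0}$ on $X$, with spectrum $\sigma(A)$ and resolvent $R(z,A)=(z-A)^{-1}$. Put $K=\{t\in\mathbb R: it\in\sigma(A)\}$ and assume that there are $a\in(0,\infty)$ and $\theta\in(\tfrac12,\infty)$ with $K\subset(-a,a)$ and $\sup_{|t|\ge a}|t|^{\theta}\,\|R(it,A)\|<\infty$. Let $F\subset\mathbb R\setminus K$ be closed. Then there exists $G\in L^1(\mathbb R,L(X))$ such that the following holds. Let $\varphi\in L^\infty(\mathbb R,X)$ have Beurling spectrum $sp(\varphi)\subset F$, where $$sp(\varphi)=\Big\{\omega\in\mathbb R:\ f\in L^1(\mathbb R,\mathbb C)\text{ and }\varphi*f=0\text{ imply }\int_{\mathbb R}f(t)e^{-i\omega t}\,dt=0\Big\}.$$ Let $\mathbb J\in\{\mathbb R,[0,\infty)\}$, let $BUC$ denote bounded uniformly continuous functions, and let $\mathcal F$ be a class of functions $\mathbb J\to X$ such that 1. $\mathcal F$ is a linear subspace of $L^1_{loc}(\mathbb J,X)$; 2.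 if $\varphi_n\in\mathcal F\cap BUC(\mathbb J,X)$ for $n\in\mathbb N$ and $\varphi_n\to\psi$ uniformly on $\mathbb J$, then $\psi\in\mathcal F$; 3. if $f\in BUC(\mathbb R,X)$ and $f|_{\mathbb J}\in\mathcal F$, then $f(a'+\cdot)|_{\mathbb J}\in\mathcal F$ for all $a'\in\mathbb R$; 4. if $f\in BUC(\mathbb R,X)$ and $f|_{\mathbb J}\in\mathcal F$, then $(B\circ f)|_{\mathbb J}\in\mathcal F$ for all $B\in L(X)$. Suppose that $\varphi|_{\mathbb J}$ belongs to the mean class $$\mathcal M\mathcal F=\Big\{f\in L^1_{loc}(\mathbb J,X):\ M_hf:=\frac1h\int_0^hf(\cdot+s)\,ds\in\mathcal F\text{ for all }h>0\Big\}.$$ Then $u_\varphi(t):=(G*\varphi)(t)=\int_{\mathbb R}G(s)\varphi(t-s)\,ds$ exists as a Bochner integral for every $t\in\mathbb R$; $u_\varphi$ is a mild solution of $u'=Au+\varphi$ on $\mathbb R$, that is, $u_\varphi$ is continuous and for all $t\in\mathbb R$ one has $\int_0^tu_\varphi(s)\,ds\in D(A)$ and $u_\varphi(t)=u_\varphi(0)+A\int_0^tu_\varphi(s)\,ds+\int_0^t\varphi(s)\,ds$;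 moreover $u_\varphi\in BUC(\mathbb R,X)$ and $u_\varphi|_{\mathbb J}\in\mathcal F$. -/

import Mathlib

open MeasureTheory Set Filter Topology
open scoped NNReal ENNReal

namespace NonResonance

/-! ### Strongly continuous semigroups and their generators -/

/-- A `C₀`-semigroup `(T(t))_{t ≥ 0}` of bounded operators on `X`. -/
structure C0Semigroup (X : Type*) [NormedAddCommGroup X] [NormedSpace ℂ X] where
  toFun : ℝ≥0 → X →L[ℂ] X
  toFun_zero : toFun 0 = ContinuousLinearMap.id ℂ X
  toFun_add : ∀ s t : ℝ≥0, toFun (s + t) = (toFun s).comp (toFun t)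
  strongly_continuous : ∀ x : X, Tendsto (fun t : ℝ≥0 => toFun t x) (𝓝 0) (𝓝 x)

section Generator

variable {X : Type*} [NormedAddCommGroup X] [NormedSpace ℂ X]

/-- The graph of the generator: pairs `(x, y)` with `y = lim_{t ↓ 0} (T(t) x - x) / t`. -/
def C0Semigroup.generatorGraph (T : C0Semigroup X) : Submodule ℂ (X × X) where
  carrier := {p | Tendsto (fun t : ℝ≥0 => ((t : ℝ)⁻¹ : ℂ) • (T.toFun t p.1 - p.1))
    (𝓝[>] 0) (𝓝 p.2)}
  zero_mem' := by simp
  add_mem' := by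
    intro p q hp hq
    simp only [mem_ofPred_eq] at hp hq ⊢
    refine (hp.add hq).congr fun t => ?_
    rw [← smul_add, Prod.fst_add, map_add]
    congr 1
    abel
  smul_mem' := by
    intro c p hp
    simp only [mem_ofPred_eq] at hp ⊢
    refine (hp.const_smul c).congr fun t => ?_
    rw [Prod.smul_fst, map_smul, ← smul_sub, smul_comm]

/-- The generator `A : D(A) → X` of a `C₀`-semigroup, as a partially defined linear operator:
`D(A)` is the set of `x` for which `lim_{t ↓ 0} (T(t) x - x) / t` exists, and `A x` is the limit. -/
noncomputable def C0Semigroup.generator (T : C0Semigroup X) : X →ₗ.[ℂ] X :=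
  T.generatorGraph.toLinearPMap

/-- The generator does what its description says. -/
theorem C0Semigroup.mem_graph_generator (T : C0Semigroup X) (x y : X) :
    (x, y) ∈ T.generator.graph ↔
      Tendsto (fun t : ℝ≥0 => ((t : ℝ)⁻¹ : ℂ) • (T.toFun t x - x)) (𝓝[>] 0) (𝓝 y) := by
  have h : T.generator.graph = T.generatorGraph := by
    refine Submodule.toLinearPMap_graph_eq _ ?_
    rintro ⟨x, y⟩ hxy (rfl : x = 0)
    have h0 : Tendsto (fun t : ℝ≥0 => ((t : ℝ)⁻¹ : ℂ) • (T.toFun t (0 : X) - 0))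
      (𝓝[>] 0) (𝓝 y) := hxy
    simp only [map_zero, sub_zero, smul_zero] at h0
    exact (tendsto_nhds_unique h0 tendsto_const_nhds)
  rw [h]
  rfl

end Generator

/-! ### Resolvent and spectrum of a partially defined operator -/

section Spectrum

variable {X : Type*} [NormedAddCommGroup X] [NormedSpace ℂ X]

/-- `R` is a bounded two-sided inverse of `z - A : D(A) → X`. -/
def IsResolventAt (A : X →ₗ.[ℂ] X) (z : ℂ) (R : X →L[ℂ] X) : Prop :=
  (∀ x : X, ∃ h : R x ∈ A.domain, z • R x - A ⟨R x, h⟩ = x) ∧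
    ∀ x : A.domain, R (z • (x : X) - A x) = x

/-- The spectrum `σ(A)`: those `z` for which `z - A` has no bounded inverse. -/
def unboundedSpectrum (A : X →ₗ.[ℂ] X) : Set ℂ :=
  {z | ¬ ∃ R : X →L[ℂ] X, IsResolventAt A z R}

open Classical in
/-- The resolvent `R(z, A) = (z - A)⁻¹` for `z ∉ σ(A)` (and `0` for `z ∈ σ(A)`). -/
noncomputable def unboundedResolvent (A : X →ₗ.[ℂ] X) (z : ℂ) : X →L[ℂ] X :=
  if h : ∃ R : X →L[ℂ] X, IsResolventAt A z R then h.choose else 0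

/-- The set `K = (1/i) (iℝ ∩ σ(A))` of real numbers. -/
def imaginarySpectrum (A : X →ₗ.[ℂ] X) : Set ℝ :=
  {t | Complex.I * (t : ℂ) ∈ unboundedSpectrum A}

end Spectrum

/-! ### Functions on the line -/

section Functions

variable {X : Type*} [NormedAddCommGroup X] [NormedSpace ℂ X]

/-- The Beurling spectrum of `φ ∈ L^∞(ℝ, X)`: all `ω` such that `f ∈ L¹(ℝ, ℂ)` and `φ * f = 0`
imply `∫ f(t) e^{-iωt} dt = 0`. -/
def beurlingSpectrum (φ : ℝ → X) : Set ℝ :=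
  {ω | ∀ f : ℝ → ℂ, Integrable f → (∀ t : ℝ, ∫ s, f s • φ (t - s) = 0) →
    ∫ t : ℝ, Complex.exp (-(Complex.I * ω * t)) * f t = 0}

/-- The convolution `(G * φ)(t) = ∫ G(s) φ(t - s) ds` of an operator-valued and a vector-valued
function. -/
noncomputable def opConvolution (G : ℝ → X →L[ℂ] X) (φ : ℝ → X) (t : ℝ) : X :=
  ∫ s, G s (φ (t - s))

/-- `u` is a mild solution of `u' = A u + φ` on `ℝ`: it is continuous and, for all real `t`,
`∫₀ᵗ u ∈ D(A)` and `u(t) = u(0) + A ∫₀ᵗ u + ∫₀ᵗ φ`. -/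
def IsMildSolution (A : X →ₗ.[ℂ] X) (φ u : ℝ → X) : Prop :=
  Continuous u ∧ ∀ t : ℝ, ∃ h : (∫ s in (0 : ℝ)..t, u s) ∈ A.domain,
    u t = u 0 + A ⟨∫ s in (0 : ℝ)..t, u s, h⟩ + ∫ s in (0 : ℝ)..t, φ s

/-- `f` is bounded and uniformly continuous. -/
def IsBUC {α : Type*} [UniformSpace α] (f : α → X) : Prop :=
  UniformContinuous f ∧ ∃ C : ℝ, ∀ t, ‖f t‖ ≤ C

/-- Extension by zero of a function on `J ⊆ ℝ` to the whole line. It is used only to write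
integrals over subsets of `J`. -/
noncomputable def extendZero {J : Set ℝ} (f : J → X) : ℝ → X :=
  Function.extend Subtype.val f 0

/-- `f ∈ L¹_loc(J, X)`. -/
def MemL1loc {J : Set ℝ} (f : J → X) : Prop :=
  LocallyIntegrableOn (extendZero f) J

/-- The mean `(M_h f)(t) = (1/h) ∫₀ʰ f(t + s) ds`, for `t ∈ J`, where `J + [0, h] ⊆ J`. -/
noncomputable def mean {J : Set ℝ} (h : ℝ) (f : J → X) (t : J) : X :=
  ((h⁻¹ : ℝ) : ℂ) • ∫ s in (0 : ℝ)..h, extendZero f (t + s)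

/-- The mean class `𝓜𝓕 = {f ∈ L¹_loc(J, X) : M_h f ∈ 𝓕 for all h > 0}`. -/
def meanClass {J : Set ℝ} (𝓕 : Set (J → X)) : Set (J → X) :=
  {f | MemL1loc f ∧ ∀ h : ℝ, 0 < h → mean h f ∈ 𝓕}

/-- The properties required of a linear class `𝓕` of functions from `J` to `X`. -/
structure IsInvariantClass {J : Set ℝ} (𝓕 : Submodule ℂ (J → X)) : Prop where
  /-- `𝓕 ⊆ L¹_loc(J, X)` -/
  locallyIntegrable : ∀ f ∈ 𝓕, MemL1loc f
  /-- uniform limits of sequences in `𝓕 ∩ BUC(J, X)` belong to `𝓕` -/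
  uniformLimit : ∀ (f : ℕ → J → X) (g : J → X), (∀ n, f n ∈ 𝓕) → (∀ n, IsBUC (f n)) →
    TendstoUniformly f g atTop → g ∈ 𝓕
  /-- `𝓕` is `BUC`-invariant: `φ ∈ BUC(ℝ, X)` and `φ|J ∈ 𝓕` imply `φ(a + ·)|J ∈ 𝓕` for all
  real `a` -/
  translate : ∀ φ : ℝ → X, IsBUC φ → J.domRestrict φ ∈ 𝓕 →
    ∀ a : ℝ, J.domRestrict (fun t => φ (a + t)) ∈ 𝓕
  /-- `φ ∈ BUC(ℝ, X)` and `φ|J ∈ 𝓕` imply `(B ∘ φ)|J ∈ 𝓕` for all bounded operators `B` -/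
  comp : ∀ φ : ℝ → X, IsBUC φ → J.domRestrict φ ∈ 𝓕 →
    ∀ B : X →L[ℂ] X, J.domRestrict (fun t => B (φ t)) ∈ 𝓕

end Functions

end NonResonance

open NonResonance

/-! Write frequencies as `t = 2πs` and `r(s) = R(2πis, A)`. Formally, `u' = Au + φ` is solved by
convolution with the inverse Fourier transform of `r`, which is undefined on the spectrum. As `F`
avoids `K`, there is a smooth compactly supported `η` equal to 1 near `K/(2π)` and vanishing near
`F/(2π)`; the kernel is `G = 𝓕⁻((1 - η) r)`. It depends on `F` alone, and inserting `η` costs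
nothing because `𝓕⁻η * φ = 0` (`fourierInv_convolution_eq_zero`).

Integrability of `G` is the analytic core (`exists_kernel`). Decay of order `|s|^(-θ)` need not make
`r` integrable, so `G` is an L¹ limit of transforms of compactly supported cutoffs, and the
differences are dyadic blocks at `|s| ~ ρ`. The Riccati equation `r' = -2πi r²` makes `r''` cubic in
`r`; a block of height `m ~ ρ^(-θ)` therefore has second derivative `O(m³)`, and its inverse
transform has L¹ norm `O(ρ m²) = O(ρ^(1-2θ))`. This is summable over `ρ = b 2^n` exactly when `θ >
1/2`.

The equation comes from the resolvent identity against one fixed bounded resolvent `R`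
(`isMildSolution_convolution`): it is multiplied by the cutoff, transformed back, convolved with `φ`
and integrated over an interval, so that only bounded operators occur. Removing the cutoff leaves
`∫u = R(z∫u + ∫φ - (u(t) - u(0)))`, which is the mild equation.

For membership in `𝓕`, the means of `G * φ` are `G` convolved with the means of `φ`. The latter are
BUC and in `𝓕`, and Riemann sums keep the convolution in `𝓕`. Finally `G * φ`, being uniformly
continuous, is the uniform limit of its own means. -/

namespace NonResonance

open scoped Convolution

/-! ### Convolution of integrable and essentially bounded functions -/

section Convolution

/-- `φ` is strongly measurable and almost everywhere bounded in norm by `M`. -/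
structure EssBoundedBy {X : Type*} [NormedAddCommGroup X] (φ : ℝ → X) (M : ℝ) : Prop where
  aestronglyMeasurable : AEStronglyMeasurable φ
  ae_norm_le : ∀ᵐ s, ‖φ s‖ ≤ M

theorem EssBoundedBy.norm {X : Type*} [NormedAddCommGroup X] {φ : ℝ → X} {M : ℝ}
    (h : EssBoundedBy φ M) : EssBoundedBy (fun s => ‖φ s‖) M :=
  ⟨h.1.norm, by simpa using h.2⟩

theorem EssBoundedBy.comp_sub_left {X : Type*} [NormedAddCommGroup X] {φ : ℝ → X} {M : ℝ}
    (h : EssBoundedBy φ M) (t : ℝ) : EssBoundedBy (fun s => φ (t - s)) M :=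
  have hq := (Measure.measurePreserving_sub_left volume t).quasiMeasurePreserving
  ⟨h.1.comp_quasiMeasurePreserving hq, hq.ae h.2⟩

theorem EssBoundedBy.of_continuous {X : Type*} [NormedAddCommGroup X] {φ : ℝ → X} {M : ℝ}
    (h : Continuous φ) (hM : ∀ s, ‖φ s‖ ≤ M) : EssBoundedBy φ M :=
  ⟨h.aestronglyMeasurable, .of_forall hM⟩

theorem MemLp.exists_essBoundedBy {X : Type*} [NormedAddCommGroup X] {φ : ℝ → X}
    (h : MemLp φ ∞) : ∃ M, EssBoundedBy φ M := by
  refine ⟨(eLpNorm φ ∞ volume).toReal, h.1, ?_⟩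
  have := h.2
  rw [eLpNorm_exponent_top] at this ⊢
  filter_upwards [enorm_ae_le_eLpNormEssSup φ volume] with s hs
  rw [← toReal_enorm]
  exact ENNReal.toReal_mono this.ne hs

variable {𝕜 E E' E'' F F' F'' : Type*} [RCLike 𝕜]
  [NormedAddCommGroup E] [NormedAddCommGroup E'] [NormedAddCommGroup F]
  [NormedAddCommGroup E''] [NormedAddCommGroup F'] [NormedAddCommGroup F'']
  [NormedSpace 𝕜 E] [NormedSpace 𝕜 E'] [NormedSpace 𝕜 F]
  [NormedSpace 𝕜 E''] [NormedSpace 𝕜 F'] [NormedSpace 𝕜 F'']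
  (B : E →L[𝕜] E' →L[𝕜] F)

theorem convolutionExistsAt_of_essBoundedBy {f : ℝ → E} {φ : ℝ → E'} {M : ℝ} (hf : Integrable f)
    (hφ : EssBoundedBy φ M) (t : ℝ) : ConvolutionExistsAt f φ t B volume := by
  have h := hφ.comp_sub_left t
  refine (hf.norm.const_mul (‖B‖ * M)).mono' (B.aestronglyMeasurable_comp₂ hf.1 h.1) ?_
  filter_upwards [h.2] with s hs
  calc _ ≤ ‖B‖ * ‖f s‖ * ‖φ (t - s)‖ := B.le_opNorm₂ _ _
    _ ≤ ‖B‖ * ‖f s‖ * M := by gcongr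
    _ = _ := by ring

variable [NormedSpace ℝ F] [NormedSpace ℝ F'] [NormedSpace ℝ F'']

theorem norm_convolution_le {f : ℝ → E} {φ : ℝ → E'} {M : ℝ} (hf : Integrable f)
    (hφ : EssBoundedBy φ M) (t : ℝ) : ‖(f ⋆[B] φ) t‖ ≤ ‖B‖ * M * ∫ s, ‖f s‖ := by
  have h := hφ.comp_sub_left t
  rw [← integral_const_mul]
  refine norm_integral_le_of_norm_le (hf.norm.const_mul (‖B‖ * M)) ?_
  filter_upwards [h.2] with s hs
  calc _ ≤ ‖B‖ * ‖f s‖ * ‖φ (t - s)‖ := B.le_opNorm₂ _ _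
    _ ≤ ‖B‖ * ‖f s‖ * M := by gcongr
    _ = _ := by ring

/-- Continuity of translations in `L¹`. -/
theorem tendsto_integral_norm_translate_sub {f : ℝ → E} (hf : Integrable f) :
    Tendsto (fun h : ℝ => ∫ s, ‖f (s + h) - f s‖) (𝓝 0) (𝓝 0) := by
  let g : ℝ → C(ℝ, ℝ) := fun h => ⟨fun s => s + h, by fun_prop⟩
  have hg : Continuous g := by
    refine ContinuousMap.continuous_of_continuous_uncurry _ ?_
    change Continuous fun p : ℝ × ℝ => p.2 + p.1
    fun_prop
  have hgm : ∀ h, MeasurePreserving (g h) volume volume := fun h =>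
    measurePreserving_add_right volume h
  have h1 : MemLp f 1 := memLp_one_iff_integrable.2 hf
  have key : Continuous fun h => Lp.compMeasurePreserving (g h) (hgm h) h1.toLp :=
    Continuous.compMeasurePreservingLp (continuous_const (y := h1.toLp)) hg hgm ENNReal.one_ne_top
  have h2 : Tendsto (fun h => ‖Lp.compMeasurePreserving (g h) (hgm h) h1.toLp - h1.toLp‖)
      (𝓝 0) (𝓝 0) := by
    have h0 : Lp.compMeasurePreserving (g 0) (hgm 0) h1.toLp = h1.toLp := by
      refine Lp.ext ((Lp.coeFn_compMeasurePreserving _ _).trans ?_)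
      have : (g 0 : ℝ → ℝ) = id := by ext s; simp [g]
      rw [this]; rfl
    have := ((key.sub (continuous_const (y := h1.toLp))).norm.tendsto 0)
    simpa [h0] using this
  refine h2.congr fun h => ?_
  rw [L1.norm_eq_integral_norm]
  refine integral_congr_ae ?_
  filter_upwards [Lp.coeFn_sub (Lp.compMeasurePreserving (g h) (hgm h) h1.toLp) h1.toLp,
    Lp.coeFn_compMeasurePreserving h1.toLp (hgm h), h1.coeFn_toLp,
    (hgm h).quasiMeasurePreserving.ae h1.coeFn_toLp] with s e1 e2 e3 e4
  rw [e1, Pi.sub_apply, e2, e3, Function.comp_apply, e4]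
  rfl

/-- The increment of `f ⋆ φ` is the convolution of the increment of `f` with `φ`, so continuity of
translations in L¹ controls it uniformly in `t`; `φ` itself need not be continuous. -/
theorem uniformContinuous_convolution {f : ℝ → E} {φ : ℝ → E'} {M : ℝ} (hf : Integrable f)
    (hφ : EssBoundedBy φ M) : UniformContinuous (f ⋆[B] φ) := by
  have key : ∀ t h : ℝ, ‖(f ⋆[B] φ) (t + h) - (f ⋆[B] φ) t‖
      ≤ ‖B‖ * M * ∫ s, ‖f (s + h) - f s‖ := by
    intro t h
    have e1 : (f ⋆[B] φ) (t + h) = ((fun s => f (s + h)) ⋆[B] φ) t := by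
      rw [convolution_def, convolution_def, ← integral_add_right_eq_self _ h]
      simp only [add_sub_add_right_eq_sub]
    have hfh : Integrable fun s => f (s + h) := hf.comp_add_right h
    have e2 : (f ⋆[B] φ) (t + h) - (f ⋆[B] φ) t = ((fun s => f (s + h) - f s) ⋆[B] φ) t := by
      rw [e1, convolution_def, convolution_def, convolution_def, ← integral_sub]
      · simp
      · exact convolutionExistsAt_of_essBoundedBy B hfh hφ t
      · exact convolutionExistsAt_of_essBoundedBy B hf hφ t
    rw [e2]
    exact norm_convolution_le B (hfh.sub hf) hφ t
  have lim : Tendsto (fun h => ‖B‖ * M * ∫ s, ‖f (s + h) - f s‖) (𝓝 0) (𝓝 0) := by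
    simpa using (tendsto_integral_norm_translate_sub hf).const_mul (‖B‖ * M)
  rw [Metric.uniformContinuous_iff]
  intro ε hε
  obtain ⟨δ, hδ, h⟩ := Metric.eventually_nhds_iff.1 (lim.eventually (gt_mem_nhds hε))
  refine ⟨δ, hδ, fun {x y} hxy => ?_⟩
  have := key y (x - y)
  rw [add_sub_cancel] at this
  rw [dist_eq_norm]
  exact this.trans_lt (h (by simpa [dist_eq_norm] using hxy))

theorem essBoundedBy_convolution {f : ℝ → E} {φ : ℝ → E'} {M : ℝ} (hf : Integrable f)
    (hφ : EssBoundedBy φ M) : EssBoundedBy (f ⋆[B] φ) (‖B‖ * M * ∫ s, ‖f s‖) :=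
  .of_continuous (uniformContinuous_convolution B hf hφ).continuous
    (norm_convolution_le B hf hφ)

theorem convolution_sub_left {f g : ℝ → E} {φ : ℝ → E'} {M : ℝ} (hf : Integrable f)
    (hg : Integrable g) (hφ : EssBoundedBy φ M) (t : ℝ) :
    ((fun s => f s - g s) ⋆[B] φ) t = (f ⋆[B] φ) t - (g ⋆[B] φ) t := by
  rw [convolution_def, convolution_def, convolution_def, ← integral_sub]
  · simp
  · exact convolutionExistsAt_of_essBoundedBy B hf hφ t
  · exact convolutionExistsAt_of_essBoundedBy B hg hφ t

/-- Fubini applies because `‖f‖ ⋆ (‖g‖ ⋆ ‖φ‖)` exists, the inner factor being bounded. Four bilinear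
maps are allowed so that scalar multipliers, operator kernels and vector functions can be mixed. -/
theorem convolution_assoc_of_essBoundedBy [CompleteSpace F] [CompleteSpace F'] [CompleteSpace F'']
    (L : E →L[𝕜] E' →L[𝕜] F) (L₂ : F →L[𝕜] E'' →L[𝕜] F')
    (L₃ : E →L[𝕜] F'' →L[𝕜] F') (L₄ : E' →L[𝕜] E'' →L[𝕜] F'')
    (hL : ∀ (x : E) (y : E') (z : E''), L₂ (L x y) z = L₃ x (L₄ y z))
    {f : ℝ → E} {g : ℝ → E'} {φ : ℝ → E''} {M : ℝ} (hf : Integrable f) (hg : Integrable g)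
    (hφ : EssBoundedBy φ M) (t : ℝ) :
    ((f ⋆[L] g) ⋆[L₂] φ) t = (f ⋆[L₃] (g ⋆[L₄] φ)) t :=
  convolution_assoc (μ := volume) (ν := volume) L L₂ L₃ L₄ hL hf.1 hg.1 hφ.1 (hf.ae_convolution_exists L hg)
    (.of_forall fun x => convolutionExistsAt_of_essBoundedBy _ hg.norm hφ.norm x)
    (convolutionExistsAt_of_essBoundedBy _ hf.norm
      (essBoundedBy_convolution (.mul ℝ ℝ) hg.norm hφ.norm) t)

end Convolution
end NonResonance

namespace NonResonance

open scoped Convolution FourierTransform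

/-! ### Fourier transforms of compactly supported `C²` functions -/

section Fourier

variable {E E' : Type*} [NormedAddCommGroup E] [NormedSpace ℂ E]
  [NormedAddCommGroup E'] [NormedSpace ℂ E']

theorem norm_fourierInv_le (f : ℝ → E) (t : ℝ) : ‖𝓕⁻ f t‖ ≤ ∫ s, ‖f s‖ := by
  rw [Real.fourierInv_eq]
  refine (norm_integral_le_integral_norm _).trans_eq ?_
  simp_rw [Circle.norm_smul]

theorem continuous_fourierInv {f : ℝ → E} (hf : Integrable f) : Continuous (𝓕⁻ f) := by
  have h : Continuous (𝓕 f) :=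
    VectorFourier.fourierIntegral_continuous Real.continuous_fourierChar
      (innerSL ℝ).continuous₂ hf
  have e : 𝓕⁻ f = fun t => 𝓕 f (-t) := funext fun t => Real.fourierInv_eq_fourier_neg f t
  rw [e]
  exact h.comp continuous_neg

theorem integrable_fourierChar_smul {f : ℝ → E} (hf : Integrable f) (t : ℝ) :
    Integrable fun s => Real.fourierChar (inner ℝ s t) • f s := by
  have := (Real.fourierIntegral_convergent_iff (f := f) (μ := volume) (-t)).2 hf
  simpa using this

theorem fourierInv_add {f g : ℝ → E} (hf : Integrable f) (hg : Integrable g) (t : ℝ) :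
    𝓕⁻ (fun s => f s + g s) t = 𝓕⁻ f t + 𝓕⁻ g t := by
  simp only [Real.fourierInv_eq, smul_add]
  exact integral_add (integrable_fourierChar_smul hf t) (integrable_fourierChar_smul hg t)

theorem fourierInv_sub {f g : ℝ → E} (hf : Integrable f) (hg : Integrable g) (t : ℝ) :
    𝓕⁻ (fun s => f s - g s) t = 𝓕⁻ f t - 𝓕⁻ g t := by
  simp only [Real.fourierInv_eq, smul_sub]
  exact integral_sub (integrable_fourierChar_smul hf t) (integrable_fourierChar_smul hg t)

theorem fourierInv_clm [CompleteSpace E] [CompleteSpace E'] (L : E →L[ℂ] E') {f : ℝ → E}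
    (hf : Integrable f) (t : ℝ) : 𝓕⁻ (fun s => L (f s)) t = L (𝓕⁻ f t) := by
  simp only [Real.fourierInv_eq]
  rw [← L.integral_comp_comm (integrable_fourierChar_smul hf t)]
  simp [Circle.smul_def]

theorem hasDerivAt_fourierInv {f : ℝ → E} (hf : Continuous f) (hs : HasCompactSupport f) (t : ℝ) :
    HasDerivAt (𝓕⁻ f) (𝓕⁻ (fun x : ℝ => (2 * Real.pi * Complex.I * x) • f x) t) t := by
  have hf' : Integrable fun x : ℝ => x • f x :=
    (continuous_id.smul hf).integrable_of_hasCompactSupport hs.smul_left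
  have h := Real.hasDerivAt_fourier (hf.integrable_of_hasCompactSupport hs) hf' (-t)
  have h2 := h.scomp t (hasDerivAt_neg t)
  have e : 𝓕⁻ f = 𝓕 f ∘ Neg.neg := funext fun t => Real.fourierInv_eq_fourier_neg f t
  rw [e]
  convert h2 using 1
  rw [Real.fourierInv_eq_fourier_neg, neg_one_smul, Real.fourier_eq, Real.fourier_eq,
    ← integral_neg]
  congr 1 with x
  simp [← smul_neg]

section Norm

variable {E : Type*} [NormedAddCommGroup E] {D : ℝ → E}

theorem norm_integral_le_of_support {ρ α : ℝ} (hρ : 0 ≤ ρ) (hD : Continuous D)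
    (hs : ∀ x, ρ < |x| → D x = 0) (hα : ∀ x, ‖D x‖ ≤ α) : ∫ x, ‖D x‖ ≤ 2 * ρ * α := by
  have h0 : ∫ x, ‖D x‖ = ∫ x in Icc (-ρ) ρ, ‖D x‖ := by
    refine (setIntegral_eq_integral_of_forall_compl_eq_zero fun x hx => ?_).symm
    rw [norm_eq_zero]
    refine hs x ?_
    rw [mem_Icc, ← abs_le] at hx
    exact not_le.1 hx
  rw [h0]
  calc ∫ x in Icc (-ρ) ρ, ‖D x‖ ≤ ∫ x in Icc (-ρ) ρ, α :=
        setIntegral_mono hD.norm.continuousOn.integrableOn_Icc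
          continuousOn_const.integrableOn_Icc hα
    _ = 2 * ρ * α := by
        simp only [integral_const, measureReal_restrict_apply_univ, Real.volume_real_Icc,
          smul_eq_mul]
        rw [max_eq_left (by linarith)]; ring

theorem hasCompactSupport_of_abs {ρ : ℝ} (hs : ∀ x, ρ < |x| → D x = 0) : HasCompactSupport D :=
  HasCompactSupport.intro (isCompact_Icc (a := -ρ) (b := ρ)) fun x hx => by
    refine hs x ?_
    rw [mem_Icc, ← abs_le] at hx
    exact not_le.1 hx

end Norm

variable {D : ℝ → E}

/-- Add `‖𝓕⁻D‖ ≤ ‖D‖₁ ≤ 2ρα` and `t²‖𝓕⁻D‖ ≤ ‖D''‖₁ ≤ 2ρακ²`, the second divided by `κ²`; the factor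
`(2π)² ≥ 1` is discarded. Bounding `D''` by `ακ²` makes `κ` the width of the transform, so its L¹
norm is of order `ρακ`. -/
theorem norm_fourierInv_le_of_deriv2 {ρ α κ : ℝ} (hρ : 0 ≤ ρ) (hκ : 0 < κ)
    (hD : ContDiff ℝ 2 D) (hs : ∀ x, ρ < |x| → D x = 0) (hα : ∀ x, ‖D x‖ ≤ α)
    (hβ : ∀ x, ‖iteratedDeriv 2 D x‖ ≤ α * κ ^ 2) (t : ℝ) :
    ‖𝓕⁻ D t‖ ≤ 4 * ρ * α * (1 + (κ⁻¹ * t) ^ 2)⁻¹ := by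
  have hα0 : 0 ≤ α := (norm_nonneg _).trans (hα 0)
  have hc := hasCompactSupport_of_abs hs
  have hci : ∀ n : ℕ, HasCompactSupport (iteratedDeriv n D) := fun n => by
    induction n with
    | zero => simpa using hc
    | succ n ih => rw [iteratedDeriv_succ]; exact ih.deriv
  have hcont : ∀ n : ℕ, (n : ℕ∞) ≤ 2 → Continuous (iteratedDeriv n D) := fun n hn =>
    hD.continuous_iteratedDeriv n (by exact_mod_cast hn)
  have h1 : ‖𝓕⁻ D t‖ ≤ 2 * ρ * α :=
    (norm_fourierInv_le D t).trans (norm_integral_le_of_support hρ hD.continuous hs hα)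
  have hs2 : ∀ x, ρ < |x| → iteratedDeriv 2 D x = 0 := by
    intro x hx
    have : D =ᶠ[𝓝 x] fun _ => 0 := by
      filter_upwards [(isOpen_lt continuous_const continuous_abs).mem_nhds hx] with y hy
      exact hs y hy
    rw [Filter.EventuallyEq.iteratedDeriv_eq 2 this]
    simp
  have h2 : ‖𝓕 (iteratedDeriv 2 D) (-t)‖ ≤ 2 * ρ * (α * κ ^ 2) := by
    rw [← Real.fourierInv_eq_fourier_neg]
    exact (norm_fourierInv_le _ t).trans
      (norm_integral_le_of_support hρ (hcont 2 le_rfl) hs2 hβ)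
  rw [Real.fourier_iteratedDeriv (N := 2) (n := 2) (by exact_mod_cast hD)
    (fun n hn => (hcont n hn).integrable_of_hasCompactSupport (hci n)) le_rfl,
    norm_smul, ← Real.fourierInv_eq_fourier_neg] at h2
  have h3 : t ^ 2 ≤ ‖(2 * (Real.pi : ℂ) * Complex.I * ((-t : ℝ) : ℂ)) ^ 2‖ := by
    simp only [norm_pow, norm_mul, Complex.norm_I, Complex.norm_real, Complex.norm_ofNat,
      Real.norm_eq_abs, abs_neg, mul_pow, sq_abs]
    have : (1 : ℝ) ≤ 2 ^ 2 * Real.pi ^ 2 := by nlinarith [Real.pi_gt_three]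
    nlinarith [mul_le_mul_of_nonneg_right this (sq_nonneg t)]
  have h4 : t ^ 2 * ‖𝓕⁻ D t‖ ≤ 2 * ρ * (α * κ ^ 2) :=
    (mul_le_mul_of_nonneg_right h3 (norm_nonneg _)).trans h2
  have h5 : 0 < 1 + (κ⁻¹ * t) ^ 2 := by positivity
  rw [← div_eq_mul_inv, le_div_iff₀ h5]
  have h6 : (κ⁻¹ * t) ^ 2 * ‖𝓕⁻ D t‖ ≤ 2 * ρ * α := by
    calc (κ⁻¹ * t) ^ 2 * ‖𝓕⁻ D t‖ = (κ ^ 2)⁻¹ * (t ^ 2 * ‖𝓕⁻ D t‖) := by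
          rw [mul_pow, inv_pow]; ring
      _ ≤ (κ ^ 2)⁻¹ * (2 * ρ * (α * κ ^ 2)) := by gcongr
      _ = 2 * ρ * α := by field_simp
  nlinarith

theorem integrable_inv_one_add_mul_sq {κ : ℝ} (hκ : 0 < κ) :
    Integrable fun t : ℝ => (1 + (κ⁻¹ * t) ^ 2)⁻¹ :=
  (integrable_inv_one_add_sq).comp_mul_left' (inv_pos.2 hκ).ne'

theorem integral_norm_fourierInv_le {ρ α κ : ℝ} (hρ : 0 ≤ ρ) (hκ : 0 < κ)
    (hD : ContDiff ℝ 2 D) (hs : ∀ x, ρ < |x| → D x = 0) (hα : ∀ x, ‖D x‖ ≤ α)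
    (hβ : ∀ x, ‖iteratedDeriv 2 D x‖ ≤ α * κ ^ 2) :
    Integrable (𝓕⁻ D) ∧ ∫ t, ‖𝓕⁻ D t‖ ≤ 4 * Real.pi * (ρ * (α * κ)) := by
  have hb := norm_fourierInv_le_of_deriv2 hρ hκ hD hs hα hβ
  have hI := (integrable_inv_one_add_mul_sq hκ).const_mul (4 * ρ * α)
  have hm : Continuous (𝓕⁻ D) := continuous_fourierInv
    (hD.continuous.integrable_of_hasCompactSupport (hasCompactSupport_of_abs hs))
  have hint : Integrable (𝓕⁻ D) := hI.mono' hm.aestronglyMeasurable (.of_forall hb)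
  refine ⟨hint, (integral_mono hint.norm hI hb).trans_eq ?_⟩
  rw [integral_const_mul, Measure.integral_comp_mul_left (fun t : ℝ => (1 + t ^ 2)⁻¹),
    integral_univ_inv_one_add_sq, inv_inv, abs_of_pos hκ, smul_eq_mul]
  ring

theorem integrable_fourierInv (hD : ContDiff ℝ 2 D) (hs : HasCompactSupport D) :
    Integrable (𝓕⁻ D) := by
  obtain ⟨α, hα⟩ := hD.continuous.bounded_above_of_compact_support hs
  have hs2 : HasCompactSupport (iteratedDeriv 2 D) := by
    rw [iteratedDeriv_succ, iteratedDeriv_one]; exact hs.deriv.deriv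
  obtain ⟨β, hβ⟩ := (hD.continuous_iteratedDeriv 2 le_rfl).bounded_above_of_compact_support hs2
  obtain ⟨ρ, hρ⟩ := hs.isCompact.isBounded.subset_closedBall 0
  have hα0 : 0 ≤ α := (norm_nonneg _).trans (hα 0)
  have hβ0 : 0 ≤ β := (norm_nonneg _).trans (hβ 0)
  -- `κ = 1 + β` is positive and gives `β ≤ (α + 1)κ²`; `|ρ|` guards against a negative radius.
  refine (integral_norm_fourierInv_le (ρ := |ρ|) (α := α + 1) (κ := 1 + β) (abs_nonneg _)
    (by linarith) hD ?_ (fun x => (hα x).trans (by linarith)) (fun x => (hβ x).trans ?_)).1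
  · intro x hx
    by_contra h
    have := hρ (subset_tsupport D h)
    rw [mem_closedBall_zero_iff, Real.norm_eq_abs] at this
    linarith [le_abs_self ρ]
  · nlinarith [mul_nonneg hα0 hβ0, mul_nonneg hα0 (sq_nonneg (1 + β))]

theorem integrable_of_contDiff {n : WithTop ℕ∞} (hD : ContDiff ℝ n D) (hs : HasCompactSupport D) :
    Integrable D :=
  hD.continuous.integrable_of_hasCompactSupport hs

theorem fourier_fourierInv [CompleteSpace E] (hD : ContDiff ℝ 2 D) (hs : HasCompactSupport D) :
    𝓕 (𝓕⁻ D) = D := by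
  refine hD.continuous.fourier_fourierInv_eq (integrable_of_contDiff hD hs) ?_
  have e : 𝓕 D = fun t => 𝓕⁻ D (-t) := funext fun t => by
    rw [Real.fourierInv_eq_fourier_neg, neg_neg]
  rw [e]
  exact (integrable_fourierInv hD hs).comp_neg

/-- The inverse Fourier transform turns products into convolutions. -/
theorem fourierInv_convolution [CompleteSpace E] {q : ℝ → ℂ} (hq : ContDiff ℝ 2 q)
    (hqs : HasCompactSupport q) (hD : ContDiff ℝ 2 D) (hs : HasCompactSupport D) :
    𝓕⁻ q ⋆[ContinuousLinearMap.lsmul ℂ ℂ] 𝓕⁻ D = 𝓕⁻ (fun x => q x • D x) := by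
  have iq := integrable_fourierInv hq hqs
  have iD := integrable_fourierInv hD hs
  have hF : 𝓕 (𝓕⁻ q ⋆[ContinuousLinearMap.lsmul ℂ ℂ] 𝓕⁻ D) = fun x => q x • D x := by
    ext x
    rw [Real.fourier_smul_convolution_eq iq iD, fourier_fourierInv hq hqs,
      fourier_fourierInv hD hs]
  have hb : EssBoundedBy (𝓕⁻ D) (∫ s, ‖D s‖) :=
    .of_continuous (continuous_fourierInv (integrable_of_contDiff hD hs)) (norm_fourierInv_le D)
  have hc := (uniformContinuous_convolution (ContinuousLinearMap.lsmul ℂ ℂ) iq hb).continuous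
  rw [← hF, hc.fourierInv_fourier_eq (iq.integrable_convolution _ iD)]
  rw [hF]
  exact integrable_of_contDiff (hq.smul hD) hs.smul_left

theorem fourierInv_comp_div {q : ℝ → ℂ} {c : ℝ} (hc : 0 < c) (t : ℝ) :
    𝓕⁻ (fun s => q (s / c)) t = (c : ℂ) * 𝓕⁻ q (c * t) := by
  simp only [Real.fourierInv_eq]
  have := Measure.integral_comp_div (fun s : ℝ => Real.fourierChar (inner ℝ s (c * t)) • q s) c
  rw [abs_of_pos hc] at this
  rw [← smul_eq_mul, Complex.coe_smul, ← this]
  congr 1 with s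
  have : inner ℝ s t = inner ℝ (s / c) (c * t) := by
    simp only [RCLike.inner_apply, conj_trivial]
    field_simp
  rw [this]

/-- Approximate identities with compactly supported Fourier transform. -/
theorem tendsto_fourierInv_convolution [CompleteSpace E] {q : ℝ → ℂ} (hq : ContDiff ℝ 2 q)
    (hqs : HasCompactSupport q) {φ : ℝ → E} (hφ : Continuous φ) {M : ℝ} (hM : ∀ s, ‖φ s‖ ≤ M)
    {c : ℕ → ℝ} (hc0 : ∀ n, 0 < c n) (hc : Tendsto c atTop atTop) (t : ℝ) :
    Tendsto (fun n => (𝓕⁻ (fun s => q (s / c n)) ⋆[ContinuousLinearMap.lsmul ℂ ℂ] φ) t) atTop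
      (𝓝 (q 0 • φ t)) := by
  have hi := integrable_fourierInv hq hqs
  have h0 : ∫ s, 𝓕⁻ q s = q 0 := by
    have := congrFun (fourier_fourierInv hq hqs) 0
    rw [Real.fourier_eq] at this
    simpa using this
  -- Rescaling moves `c n` from the kernel into the argument of `φ`, so that dominated convergence
  -- applies with the fixed majorant `‖𝓕⁻ q‖ * M`.
  have h1 : ∀ n, (𝓕⁻ (fun s => q (s / c n)) ⋆[ContinuousLinearMap.lsmul ℂ ℂ] φ) t
      = ∫ s, 𝓕⁻ q s • φ (t - s / c n) := by
    intro n
    have := Measure.integral_comp_mul_left (fun s : ℝ => 𝓕⁻ q s • φ (t - s / c n)) (c n)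
    rw [abs_of_pos (inv_pos.2 (hc0 n)), eq_inv_smul_iff₀ (hc0 n).ne', ← integral_smul] at this
    rw [← this, convolution_def]
    congr 1 with s
    rw [fourierInv_comp_div (hc0 n), mul_div_cancel_left₀ _ (hc0 n).ne', ContinuousLinearMap.lsmul_apply,
      mul_smul, Complex.coe_smul]
  simp_rw [h1]
  rw [← h0, ← integral_smul_const]
  refine tendsto_integral_of_dominated_convergence (fun s => ‖𝓕⁻ q s‖ * M) (fun n => ?_)
    (hi.norm.mul_const M) (fun n => .of_forall fun s => ?_) (.of_forall fun s => ?_)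
  · exact hi.1.smul (Continuous.aestronglyMeasurable (by fun_prop))
  · rw [norm_smul]; gcongr; exact hM _
  · refine Tendsto.const_smul ?_ _
    have : Tendsto (fun n => t - s / c n) atTop (𝓝 (t - 0)) :=
      tendsto_const_nhds.sub (tendsto_const_nhds.div_atTop hc)
    rw [sub_zero] at this
    exact (hφ.tendsto t).comp this

end Fourier
end NonResonance

namespace NonResonance

open scoped Convolution FourierTransform ContDiff Manifold

/-! ### Spectral synthesis for smooth multipliers -/

section Beurling

variable {X : Type*} [NormedAddCommGroup X] [NormedSpace ℂ X]

theorem two_le_infty : (2 : WithTop ℕ∞) ≤ ((⊤ : ℕ∞) : WithTop ℕ∞) :=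
  WithTop.coe_le_coe.2 (le_top : (2 : ℕ∞) ≤ ⊤)

theorem exists_contDiff_bump : ∃ χ : ℝ → ℂ, ContDiff ℝ ∞ χ ∧ (∀ x, |x| ≤ 1 → χ x = 1) ∧
    ∀ x, 2 ≤ |x| → χ x = 0 := by
  let b : ContDiffBump (0 : ℝ) := ⟨1, 2, one_pos, one_lt_two⟩
  refine ⟨fun x => (b x : ℂ), Complex.ofRealCLM.contDiff.comp b.contDiff, fun x hx => ?_,
    fun x hx => ?_⟩
  · change ((b x : ℝ) : ℂ) = 1
    rw [b.one_of_mem_closedBall (by simpa using hx), Complex.ofReal_one]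
  · change ((b x : ℝ) : ℂ) = 0
    rw [b.zero_of_le_dist (by simpa using hx), Complex.ofReal_zero]

theorem fourierInv_comp_sub_div {q : ℝ → ℂ} {c : ℝ} (hc : 0 < c) (w t : ℝ) :
    𝓕⁻ (fun s => q ((s - w) / c)) t = Real.fourierChar (w * t) * ((c : ℂ) * 𝓕⁻ q (c * t)) := by
  rw [← fourierInv_comp_div hc]
  simp only [Real.fourierInv_eq]
  rw [← integral_add_right_eq_self _ w, ← integral_const_mul]
  congr 1 with s
  have : inner ℝ (s + w) t = w * t + inner ℝ s t := by
    simp only [RCLike.inner_apply, conj_trivial]; ring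
  rw [this, AddChar.map_add_eq_mul, add_sub_cancel_right, mul_smul]
  rfl

theorem integral_norm_translate_sub_le {f : ℝ → ℂ} (hf : Integrable f) (h : ℝ) :
    ∫ s, ‖f (s + h) - f s‖ ≤ 2 * ∫ s, ‖f s‖ := by
  have hh : Integrable fun s => f (s + h) := hf.comp_add_right h
  calc ∫ s, ‖f (s + h) - f s‖ ≤ ∫ s, (‖f (s + h)‖ + ‖f s‖) :=
        integral_mono (hh.sub hf).norm (hh.norm.add hf.norm) fun s => norm_sub_le _ _
    _ = 2 * ∫ s, ‖f s‖ := by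
        rw [integral_add hh.norm hf.norm, integral_add_right_eq_self (fun s => ‖f s‖)]; ring

variable [CompleteSpace X] {φ : ℝ → X} {M : ℝ}

/-- A multiplier supported near a frequency `w` annihilates `φ` as soon as some integrable function
whose Fourier transform does not vanish at `w` does. -/
theorem exists_ball_fourierInv_convolution_eq_zero (hφ : EssBoundedBy φ M) {g : ℝ → ℂ}
    (hg : Integrable g) (hgφ : ∀ t, (g ⋆[ContinuousLinearMap.lsmul ℂ ℂ] φ) t = 0) {w : ℝ}
    (hw : 𝓕 g w ≠ 0) :
    ∃ ε > 0, ∀ p : ℝ → ℂ, ContDiff ℝ ∞ p → HasCompactSupport p → tsupport p ⊆ Metric.ball w ε →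
      ∀ t, (𝓕⁻ p ⋆[ContinuousLinearMap.lsmul ℂ ℂ] φ) t = 0 := by
  obtain ⟨χ, hχ, hχ1, hχ2⟩ := exists_contDiff_bump
  have hχs : HasCompactSupport χ := hasCompactSupport_of_abs fun x hx => hχ2 x hx.le
  have h2 := two_le_infty
  set e₁ := 𝓕⁻ χ
  have hi₁ : Integrable e₁ := integrable_fourierInv (hχ.of_le h2) hχs
  have hc₁ : Continuous e₁ := continuous_fourierInv (integrable_of_contDiff hχ hχs)
  -- `μ` is the L¹ modulus of continuity of `𝓕⁻ χ`. Shrinking `χ` to width `ε` about `w` turns a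
  -- shift by `s` into one by `εs`, up to a character, so a function with spectrum in a small ball
  -- is almost a multiple of that character.
  let μ : ℝ → ℝ := fun h => ∫ s, ‖e₁ (s + h) - e₁ s‖
  have hμ0 : Tendsto μ (𝓝 0) (𝓝 0) := tendsto_integral_norm_translate_sub hi₁
  have hμm : Measurable μ := by
    have : StronglyMeasurable (Function.uncurry fun h s : ℝ => ‖e₁ (s + h) - e₁ s‖) :=
      Continuous.stronglyMeasurable (by unfold Function.uncurry; fun_prop)
    exact this.integral_prod_right.measurable
  have hμb : ∀ h, ‖μ h‖ ≤ 2 * ∫ s, ‖e₁ s‖ := fun h => by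
    rw [Real.norm_of_nonneg (integral_nonneg fun s => norm_nonneg _)]
    exact integral_norm_translate_sub_le hi₁ h
  have hlim : Tendsto (fun ε : ℝ => ∫ s, ‖g s‖ * μ (ε * -s)) (𝓝[>] 0) (𝓝 0) := by
    have : ∫ s, ‖g s‖ * (0 : ℝ) = 0 := by simp
    have := this.symm
    rw [show 𝓝 (0 : ℝ) = 𝓝 (∫ s, ‖g s‖ * (0 : ℝ)) by rw [← this]]
    refine tendsto_integral_filter_of_dominated_convergence
      (fun s => ‖g s‖ * (2 * ∫ s, ‖e₁ s‖)) (.of_forall fun ε => ?_) (.of_forall fun ε => ?_)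
      (hg.norm.mul_const _) (.of_forall fun s => ?_)
    · exact hg.norm.1.mul (hμm.comp (by fun_prop)).aestronglyMeasurable
    · refine .of_forall fun s => ?_
      rw [norm_mul, norm_norm]
      gcongr
      exact hμb _
    · refine Tendsto.const_mul _ (hμ0.comp ?_)
      have : Tendsto (fun ε : ℝ => ε * -s) (𝓝 0) (𝓝 (0 * -s)) :=
        (continuous_id.mul continuous_const).tendsto 0
      rw [zero_mul] at this
      exact this.mono_left nhdsWithin_le_nhds
  have hpos : 0 < ‖𝓕 g w‖ / 2 := by positivity
  obtain ⟨ε, hε, hε0⟩ := ((hlim.eventually (gt_mem_nhds hpos)).and self_mem_nhdsWithin).exists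
  refine ⟨ε, hε0, fun p hp hps hpt => ?_⟩
  let q : ℝ → ℂ := fun x => χ ((x - w) / ε)
  have hq : ContDiff ℝ 2 q := (hχ.of_le h2).comp (by fun_prop)
  have hqs : HasCompactSupport q := by
    refine HasCompactSupport.intro (isCompact_closedBall w (2 * ε)) fun x hx => hχ2 _ ?_
    rw [Metric.mem_closedBall, not_le, Real.dist_eq] at hx
    rw [abs_div, abs_of_pos hε0, le_div_iff₀ hε0]
    exact hx.le
  have hqi : Integrable (𝓕⁻ q) := integrable_fourierInv hq hqs
  have hpi : Integrable (𝓕⁻ p) := integrable_fourierInv (hp.of_le h2) hps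
  have hqp : (fun x => q x • p x) = p := by
    ext x
    by_cases hx : x ∈ tsupport p
    · have hx' := hpt hx
      rw [Metric.mem_ball, Real.dist_eq] at hx'
      have : q x = 1 := hχ1 _ (by
        rw [abs_div, abs_of_pos hε0, div_le_one hε0]; exact hx'.le)
      rw [this, one_smul]
    · rw [image_eq_zero_of_notMem_tsupport hx, smul_zero]
  set k := 𝓕⁻ p ⋆[ContinuousLinearMap.lsmul ℂ ℂ] φ with hk
  have hkb := essBoundedBy_convolution (ContinuousLinearMap.lsmul ℂ ℂ) hpi hφ
  have hkn := norm_convolution_le (ContinuousLinearMap.lsmul ℂ ℂ) hpi hφ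
  have hkc := (uniformContinuous_convolution (ContinuousLinearMap.lsmul ℂ ℂ) hpi hφ).continuous
  rw [← hk] at hkb hkn hkc
  -- The supremum `S` is finite, and the aim is the self-improving bound `S ≤ S / 2`.
  have hbdd : BddAbove (range fun t => ‖k t‖) := ⟨_, forall_mem_range.2 hkn⟩
  set S := ⨆ t, ‖k t‖ with hS
  have hkS : ∀ t, ‖k t‖ ≤ S := le_ciSup hbdd
  have hS0 : 0 ≤ S := (norm_nonneg _).trans (hkS 0)
  have hkS' : EssBoundedBy k S := .of_continuous hkc hkS
  have hqk : 𝓕⁻ q ⋆[ContinuousLinearMap.lsmul ℂ ℂ] k = k := by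
    ext t
    rw [hk, ← convolution_assoc_of_essBoundedBy (ContinuousLinearMap.lsmul ℂ ℂ)
      (ContinuousLinearMap.lsmul ℂ ℂ) (ContinuousLinearMap.lsmul ℂ ℂ)
      (ContinuousLinearMap.lsmul ℂ ℂ) (fun x y z => mul_smul x y z) hqi hpi hφ,
      fourierInv_convolution hq hqs (hp.of_le h2) hps, hqp]
  have hgk : ∀ t, (g ⋆[ContinuousLinearMap.lsmul ℂ ℂ] k) t = 0 := by
    intro t
    have hcomm : g ⋆[ContinuousLinearMap.lsmul ℂ ℂ] 𝓕⁻ p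
        = 𝓕⁻ p ⋆[ContinuousLinearMap.lsmul ℂ ℂ] g := by
      rw [← convolution_flip]
      congr 1
      ext
      simp
    rw [hk, ← convolution_assoc_of_essBoundedBy (ContinuousLinearMap.lsmul ℂ ℂ)
      (ContinuousLinearMap.lsmul ℂ ℂ) (ContinuousLinearMap.lsmul ℂ ℂ)
      (ContinuousLinearMap.lsmul ℂ ℂ) (fun x y z => mul_smul x y z) hg hpi hφ, hcomm,
      convolution_assoc_of_essBoundedBy (ContinuousLinearMap.lsmul ℂ ℂ)
      (ContinuousLinearMap.lsmul ℂ ℂ) (ContinuousLinearMap.lsmul ℂ ℂ)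
      (ContinuousLinearMap.lsmul ℂ ℂ) (fun x y z => mul_smul x y z) hpi hg hφ,
      show g ⋆[ContinuousLinearMap.lsmul ℂ ℂ] φ = 0 from funext hgφ, convolution_zero]
    rfl
  -- Since `q = 1` on the support of `p`, `k = 𝓕⁻ q ⋆ k`; the shift and the character can then be
  -- moved onto `𝓕⁻ q`, where `μ` measures their difference.
  have hshift : ∀ t s, ‖k (t - s) - (Real.fourierChar (-(s * w)) : ℂ) • k t‖
      ≤ S * μ (ε * -s) := by
    intro t s
    have hqs' : Integrable fun x => 𝓕⁻ q (x - s) := hqi.comp_sub_right s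
    have hqs'' : Integrable fun x => (Real.fourierChar (-(s * w)) : ℂ) * 𝓕⁻ q x :=
      hqi.const_mul _
    have e1 : k (t - s) - (Real.fourierChar (-(s * w)) : ℂ) • k t
        = ((fun x => 𝓕⁻ q (x - s) - (Real.fourierChar (-(s * w)) : ℂ) * 𝓕⁻ q x)
          ⋆[ContinuousLinearMap.lsmul ℂ ℂ] k) t := by
      rw [convolution_sub_left _ hqs' hqs'' hkS']
      congr 1
      · conv_lhs => rw [← hqk]
        rw [convolution_def, convolution_def, ← integral_sub_right_eq_self _ s]
        simp only [sub_sub_sub_cancel_right]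
      · conv_lhs => rw [← hqk]
        rw [convolution_def, convolution_def, ← integral_smul]
        simp [mul_smul]
    have e2 : ∫ x, ‖𝓕⁻ q (x - s) - (Real.fourierChar (-(s * w)) : ℂ) * 𝓕⁻ q x‖
        = μ (ε * -s) := by
      have h3 := Measure.integral_comp_mul_left
        (fun y : ℝ => ε * ‖e₁ (y + ε * -s) - e₁ y‖) ε
      simp only [integral_const_mul] at h3
      rw [abs_of_pos (inv_pos.2 hε0), smul_eq_mul,
        inv_mul_cancel_left₀ hε0.ne', ← integral_const_mul] at h3
      change _ = ∫ y, ‖e₁ (y + ε * -s) - e₁ y‖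
      rw [← h3]
      congr 1 with x
      simp only [q]
      have hch : (Real.fourierChar (w * (x - s)) : ℂ)
          = Real.fourierChar (-(s * w)) * Real.fourierChar (w * x) := by
        rw [← Circle.coe_mul, ← AddChar.map_add_eq_mul]
        congr 2
        ring
      rw [fourierInv_comp_sub_div hε0, fourierInv_comp_sub_div hε0, hch, mul_assoc, ← mul_sub,
        ← mul_sub, ← mul_sub, norm_mul, Circle.norm_coe, one_mul, norm_mul, Circle.norm_coe,
        one_mul, norm_mul, Complex.norm_real, Real.norm_of_nonneg hε0.le,
        show ε * (x - s) = ε * x + ε * -s by ring]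
    have e3 := norm_convolution_le (ContinuousLinearMap.lsmul ℂ ℂ)
      (f := fun x => 𝓕⁻ q (x - s) - (Real.fourierChar (-(s * w)) : ℂ) * 𝓕⁻ q x)
      (hqs'.sub hqs'') hkS' t
    rw [e2] at e3
    rw [e1]
    refine e3.trans ?_
    have : ‖(ContinuousLinearMap.lsmul ℂ ℂ : ℂ →L[ℂ] X →L[ℂ] X)‖ ≤ 1 :=
      ContinuousLinearMap.opNorm_lsmul_le
    have hμn : 0 ≤ μ (ε * -s) := integral_nonneg fun s => norm_nonneg _
    calc _ ≤ 1 * S * μ (ε * -s) := by gcongr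
      _ = _ := by rw [one_mul]
  have hmain : ∀ t, ‖k t‖ ≤ S / 2 := by
    intro t
    have hgi : Integrable fun s => (Real.fourierChar (-(s * w)) : ℂ) * g s := by
      have := (Real.fourierIntegral_convergent_iff (f := g) (μ := volume) w).2 hg
      simpa [Circle.smul_def, mul_comm] using this
    -- In `g ⋆ k = 0`, replacing `k (t - s)` by its character approximation produces `𝓕 g w • k t`,
    -- so this term equals minus the error; the choice of `ε` bounds the error by half of `S‖𝓕 g
    -- w‖`.
    have e1 : 𝓕 g w • k t = -∫ s, g s • (k (t - s) - (Real.fourierChar (-(s * w)) : ℂ) • k t) := by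
      simp only [smul_sub]
      rw [integral_sub]
      · have h4 : ∫ s, g s • k (t - s) = 0 := hgk t
        rw [h4, zero_sub, neg_neg, Real.fourier_real_eq, ← integral_smul_const]
        simp only [Circle.smul_def, smul_smul, smul_eq_mul, mul_comm]
      · exact convolutionExistsAt_of_essBoundedBy (ContinuousLinearMap.lsmul ℂ ℂ) hg hkS' t
      · simp only [smul_smul]
        simp only [mul_comm (g _)]
        exact hgi.smul_const _
    have e2 : ‖𝓕 g w‖ * ‖k t‖ ≤ S * (‖𝓕 g w‖ / 2) := by
      rw [← norm_smul, e1, norm_neg]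
      have hI : Integrable fun s => ‖g s‖ * μ (ε * -s) :=
        hg.norm.mul_bdd (c := 2 * ∫ s, ‖e₁ s‖)
          (hμm.comp (by fun_prop)).aestronglyMeasurable (.of_forall fun s => hμb _)
      calc _ ≤ ∫ s, S * (‖g s‖ * μ (ε * -s)) := by
            refine norm_integral_le_of_norm_le (hI.const_mul S) (.of_forall fun s => ?_)
            rw [norm_smul]
            calc _ ≤ ‖g s‖ * (S * μ (ε * -s)) := by gcongr; exact hshift t s
              _ = _ := by ring
        _ ≤ _ := by
            rw [integral_const_mul]
            gcongr
    have : 0 < ‖𝓕 g w‖ := by positivity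
    nlinarith
  have : S ≤ S / 2 := ciSup_le hmain
  intro t
  have := hmain t
  rw [← norm_le_zero_iff]
  linarith

/-- A smooth compactly supported multiplier which vanishes near the Beurling spectrum
annihilates `φ`. -/
theorem fourierInv_convolution_eq_zero (hφ : EssBoundedBy φ M) {p : ℝ → ℂ} (hp : ContDiff ℝ ∞ p)
    (hps : HasCompactSupport p) (hpφ : ∀ x ∈ tsupport p, 2 * Real.pi * x ∉ beurlingSpectrum φ)
    (t : ℝ) : (𝓕⁻ p ⋆[ContinuousLinearMap.lsmul ℂ ℂ] φ) t = 0 := by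
  have hloc : ∀ w ∈ tsupport p, ∃ ε > 0, ∀ p : ℝ → ℂ, ContDiff ℝ ∞ p → HasCompactSupport p →
      tsupport p ⊆ Metric.ball w ε → ∀ t, (𝓕⁻ p ⋆[ContinuousLinearMap.lsmul ℂ ℂ] φ) t = 0 := by
    intro w hw
    have h := hpφ w hw
    simp only [beurlingSpectrum, mem_ofPred_eq, not_forall] at h
    obtain ⟨g, hg, hgφ, hgw⟩ := h
    refine exists_ball_fourierInv_convolution_eq_zero hφ hg hgφ (w := w) ?_
    intro h0
    rw [Real.fourier_real_eq_integral_exp_smul] at h0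
    refine hgw (Eq.trans (integral_congr_ae (.of_forall fun s => ?_)) h0)
    simp only [smul_eq_mul]
    congr 2
    push_cast
    ring
  choose! ε hε0 hε using hloc
  obtain ⟨b, hb, hcov⟩ := hps.isCompact.elim_nhds_subcover (fun w => Metric.ball w (ε w))
    fun w hw => Metric.ball_mem_nhds w (hε0 w hw)
  -- A smooth partition of unity splits `p` into finitely many multipliers, each supported in a ball
  -- where the local result applies.
  obtain ⟨ρ, hρ⟩ := SmoothPartitionOfUnity.exists_isSubordinate 𝓘(ℝ, ℝ)
    (isClosed_tsupport p) (fun w : b => Metric.ball (w : ℝ) (ε w)) (fun w => Metric.isOpen_ball)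
    (fun x hx => by
      obtain ⟨w, hw, hx⟩ := mem_iUnion₂.1 (hcov hx)
      exact mem_iUnion.2 ⟨⟨w, hw⟩, hx⟩)
  let P : b → ℝ → ℂ := fun w x => (ρ w x : ℂ) * p x
  have hP : ∀ w, ContDiff ℝ ∞ (P w) := fun w =>
    (Complex.ofRealCLM.contDiff.comp (ρ w).contMDiff.contDiff).mul hp
  have hPs : ∀ w, HasCompactSupport (P w) := fun w => hps.mul_left
  have hPi : ∀ w, Integrable (𝓕⁻ (P w)) := fun w =>
    integrable_fourierInv ((hP w).of_le two_le_infty) (hPs w)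
  have hPt : ∀ w : b, tsupport (P w) ⊆ Metric.ball (w : ℝ) (ε w) := fun w => by
    refine (closure_mono ?_).trans (hρ w)
    intro x hx hx'
    exact hx (by simp [P, hx'])
  have hsum : p = fun x => ∑ w, P w x := by
    ext x
    simp only [P]
    rw [← Finset.sum_mul, ← Complex.ofReal_sum]
    by_cases hx : x ∈ tsupport p
    · have := ρ.sum_eq_one hx
      rw [finsum_eq_sum_of_fintype] at this
      rw [this, Complex.ofReal_one, one_mul]
    · rw [image_eq_zero_of_notMem_tsupport hx, mul_zero]
  have hF : 𝓕⁻ p = fun t => ∑ w, 𝓕⁻ (P w) t := by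
    ext t
    conv_lhs => rw [hsum]
    simp only [Real.fourierInv_eq, Finset.smul_sum]
    exact integral_finsetSum _ fun w _ =>
      integrable_fourierChar_smul (integrable_of_contDiff (hP w) (hPs w)) t
  rw [hF, convolution_def]
  simp only [map_sum, sum_apply]
  rw [integral_finsetSum]
  · refine Finset.sum_eq_zero fun w _ => ?_
    exact hε w (hb w w.2) (P w) (hP w) (hPs w) (hPt w) t
  · exact fun w _ => convolutionExistsAt_of_essBoundedBy _ (hPi w) hφ t

end Beurling
end NonResonance

namespace NonResonance

/-! ### Analyticity of the resolvent -/

section Resolvent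

variable {X : Type*} [NormedAddCommGroup X] [NormedSpace ℂ X] {A : X →ₗ.[ℂ] X} {z w : ℂ}
  {R S : X →L[ℂ] X}

/-- Apply `R` to `(z - A)Sx = x - (w - z)Sx`: only the left inverse property of `R` and the right
inverse property of `S` enter. -/
theorem IsResolventAt.identity (hR : IsResolventAt A z R) (hS : IsResolventAt A w S) :
    R - S = (w - z) • (R * S) := by
  ext x
  obtain ⟨h, hx⟩ := hS.1 x
  have h1 := hR.2 ⟨S x, h⟩
  have h2 : z • S x - A ⟨S x, h⟩ = x - (w - z) • S x := by
    nth_rw 3 [← hx]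
    rw [sub_smul]
    abel
  rw [h2, map_sub, map_smul] at h1
  have h3 : R x = S x + (w - z) • R (S x) := by
    rw [← sub_eq_iff_eq_add]
    exact h1
  change R x - S x = (w - z) • R (S x)
  rw [h3]
  abel

theorem IsResolventAt.unique (hR : IsResolventAt A z R) (hS : IsResolventAt A z S) : R = S := by
  simpa [sub_eq_zero] using hR.identity hS

theorem isResolventAt_unboundedResolvent (hz : z ∉ unboundedSpectrum A) :
    IsResolventAt A z (unboundedResolvent A z) := by
  have h : ∃ R : X →L[ℂ] X, IsResolventAt A z R := by
    simpa [unboundedSpectrum] using hz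
  rw [unboundedResolvent, dif_pos h]
  exact h.choose_spec

theorem IsResolventAt.eq_unboundedResolvent (hR : IsResolventAt A z R) :
    unboundedResolvent A z = R :=
  (isResolventAt_unboundedResolvent (by simpa [unboundedSpectrum] using ⟨R, hR⟩)).unique hR

/-- On `D(A)`, `z - A = (1 + (z - w)R)(w - A)`, and the first factor commutes with `R`. -/
theorem IsResolventAt.perturb (hR : IsResolventAt A w R) (hu : IsUnit (1 + (z - w) • R)) :
    IsResolventAt A z (R * Ring.inverse (1 + (z - w) • R)) := by
  obtain ⟨u, hu⟩ := hu
  rw [← hu, Ring.inverse_unit]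
  have hcomm : R * ↑u⁻¹ = ↑u⁻¹ * R := by
    have : Commute R (u : X →L[ℂ] X) := by
      rw [hu]
      exact (Commute.one_right R).add_right ((Commute.refl R).smul_right _)
    exact this.units_inv_right.eq
  constructor
  · intro x
    obtain ⟨h, hx⟩ := hR.1 ((↑u⁻¹ : X →L[ℂ] X) x)
    refine ⟨h, ?_⟩
    have h1 : (u : X →L[ℂ] X) ((↑u⁻¹ : X →L[ℂ] X) x) = x :=
      congrArg (fun T : X →L[ℂ] X => T x) u.mul_inv
    rw [hu] at h1
    change z • R ((↑u⁻¹ : X →L[ℂ] X) x) - A ⟨R ((↑u⁻¹ : X →L[ℂ] X) x), h⟩ = x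
    set y := (↑u⁻¹ : X →L[ℂ] X) x
    calc _ = (w • R y - A ⟨R y, h⟩) + (z - w) • R y := by rw [sub_smul]; abel
      _ = y + (z - w) • R y := by rw [hx]
      _ = x := h1
  · intro x
    have h1 : R (z • (x : X) - A x) = (u : X →L[ℂ] X) x := by
      have : z • (x : X) - A x = (w • (x : X) - A x) + (z - w) • (x : X) := by
        rw [sub_smul]; abel
      rw [this, map_add, hR.2 x, hu]
      simp
    rw [hcomm]
    change (↑u⁻¹ : X →L[ℂ] X) (R (z • (x : X) - A x)) = x
    rw [h1]
    exact congrArg (fun T : X →L[ℂ] X => T x) u.inv_mul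

/-- The resolvent along the imaginary axis, in the normalization of the Fourier transform. -/
noncomputable def axisResolvent (A : X →ₗ.[ℂ] X) (s : ℝ) : X →L[ℂ] X :=
  unboundedResolvent A (Complex.I * ((2 * Real.pi * s : ℝ) : ℂ))

/-- The frequencies at which the resolvent exists. -/
def axisRegular (A : X →ₗ.[ℂ] X) : Set ℝ :=
  {s | 2 * Real.pi * s ∉ imaginarySpectrum A}

theorem axisResolvent_identity {s : ℝ} (hs : s ∈ axisRegular A) (hR : IsResolventAt A z R) :
    R - axisResolvent A s = (2 * Real.pi * Complex.I * s - z) • (R * axisResolvent A s) := by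
  refine (hR.identity (isResolventAt_unboundedResolvent hs)).trans ?_
  change _ • (R * axisResolvent A s) = _
  congr 1
  push_cast
  ring

variable [CompleteSpace X]

theorem eventually_unboundedResolvent_eq (hw : w ∉ unboundedSpectrum A) :
    ∀ᶠ z in 𝓝 w, z ∉ unboundedSpectrum A ∧ unboundedResolvent A z =
      unboundedResolvent A w * Ring.inverse (1 + (z - w) • unboundedResolvent A w) := by
  have hR := isResolventAt_unboundedResolvent hw
  have hc : Tendsto (fun z => 1 + (z - w) • unboundedResolvent A w) (𝓝 w)
      (𝓝 (1 : X →L[ℂ] X)) := by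
    have : Continuous fun z => 1 + (z - w) • unboundedResolvent A w := by fun_prop
    simpa using this.tendsto w
  have hu : ∀ᶠ T in 𝓝 (1 : X →L[ℂ] X), IsUnit T := Units.nhds 1
  filter_upwards [hc.eventually hu] with z hz
  have h := hR.perturb hz
  exact ⟨by simpa [unboundedSpectrum] using ⟨_, h⟩, h.eq_unboundedResolvent⟩

theorem contDiffAt_unboundedResolvent (hw : w ∉ unboundedSpectrum A) {n : WithTop ℕ∞} :
    ContDiffAt ℂ n (unboundedResolvent A) w := by
  refine ContDiffAt.congr_of_eventuallyEq ?_
    ((eventually_unboundedResolvent_eq hw).mono fun z h => h.2)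
  have h1 : ContDiff ℂ n fun z => 1 + (z - w) • unboundedResolvent A w := by fun_prop
  have h2 : ContDiffAt ℂ n Ring.inverse ((fun z => 1 + (z - w) • unboundedResolvent A w) w) := by
    simpa using contDiffAt_ringInverse ℂ (1 : (X →L[ℂ] X)ˣ)
  have h3 : ContDiffAt ℂ n (fun z => Ring.inverse (1 + (z - w) • unboundedResolvent A w)) w :=
    ContDiffAt.comp (g := Ring.inverse) w h2 h1.contDiffAt
  exact contDiffAt_const.mul h3

theorem hasDerivAt_unboundedResolvent (hw : w ∉ unboundedSpectrum A) :
    HasDerivAt (unboundedResolvent A) (-(unboundedResolvent A w * unboundedResolvent A w)) w := by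
  refine HasDerivAt.congr_of_eventuallyEq ?_
    ((eventually_unboundedResolvent_eq hw).mono fun z h => h.2)
  have h1 : HasDerivAt (fun z => 1 + (z - w) • unboundedResolvent A w) (unboundedResolvent A w)
      w := by
    simpa using (((hasDerivAt_id w).sub_const w).smul_const (unboundedResolvent A w)).const_add 1
  have h2 := hasFDerivAt_ringInverse (𝕜 := ℂ) (1 : (X →L[ℂ] X)ˣ)
  have h3 : HasFDerivAt Ring.inverse
      (-ContinuousLinearMap.mulLeftRight ℂ (X →L[ℂ] X) ↑(1 : (X →L[ℂ] X)ˣ)⁻¹ ↑(1 : (X →L[ℂ] X)ˣ)⁻¹)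
      ((fun z => 1 + (z - w) • unboundedResolvent A w) w) := by simpa using h2
  have h4 := (h3.comp_hasDerivAt w h1).const_mul (unboundedResolvent A w)
  simpa using! h4

theorem isOpen_axisRegular (A : X →ₗ.[ℂ] X) : IsOpen (axisRegular A) := by
  have h : IsOpen (unboundedSpectrum A)ᶜ := isOpen_iff_mem_nhds.2 fun w hw =>
    (eventually_unboundedResolvent_eq hw).mono fun z h => h.1
  exact h.preimage (f := fun s : ℝ => Complex.I * ((2 * Real.pi * s : ℝ) : ℂ)) (by fun_prop)

/-- This is the Riccati equation `r' = c r²` with `c = -2πi`. It lets a bound on the resolvent alone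
control its derivatives. -/
theorem hasDerivAt_axisResolvent {s : ℝ} (hs : s ∈ axisRegular A) :
    HasDerivAt (axisResolvent A)
      ((-(2 * Real.pi * Complex.I)) • (axisResolvent A s * axisResolvent A s)) s := by
  have h1 : HasDerivAt (fun s : ℝ => Complex.I * ((2 * Real.pi * s : ℝ) : ℂ))
      (2 * Real.pi * Complex.I) s := by
    have := (((hasDerivAt_id s).const_mul (2 * Real.pi)).ofReal_comp).const_mul Complex.I
    have e : Complex.I * ((2 * Real.pi * 1 : ℝ) : ℂ) = 2 * Real.pi * Complex.I := by
      push_cast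
      ring
    rw [e] at this
    exact this
  rw [neg_smul, ← smul_neg]
  exact (hasDerivAt_unboundedResolvent hs).scomp s h1

theorem contDiffAt_axisResolvent {s : ℝ} (hs : s ∈ axisRegular A) {n : WithTop ℕ∞} :
    ContDiffAt ℝ n (axisResolvent A) s := by
  have h1 : ContDiffAt ℝ n (fun s : ℝ => Complex.I * ((2 * Real.pi * s : ℝ) : ℂ)) s := by
    refine contDiffAt_const.mul (ContDiff.contDiffAt ?_)
    exact Complex.ofRealCLM.contDiff.comp (contDiff_const.mul contDiff_id)
  exact ((contDiffAt_unboundedResolvent (n := n) hs).restrict_scalars ℝ).comp s h1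

end Resolvent
end NonResonance

namespace NonResonance

open scoped FourierTransform ContDiff

/-! ### The kernel -/

section Kernel

theorem exists_tendsto_integral_norm_sub {E : Type*} [NormedAddCommGroup E] [CompleteSpace E]
    {f : ℕ → ℝ → E} (hf : ∀ n, Integrable (f n))
    (hs : Summable fun n => ∫ t, ‖f n t - f (n + 1) t‖) :
    ∃ G : ℝ → E, Integrable G ∧ Tendsto (fun n => ∫ t, ‖f n t - G t‖) atTop (𝓝 0) := by
  let F : ℕ → Lp E 1 (volume : Measure ℝ) := fun n => (hf n).toL1
  have hd : ∀ (G : Lp E 1 (volume : Measure ℝ)) n, dist (F n) G = ∫ t, ‖f n t - G t‖ := by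
    intro G n
    rw [dist_eq_norm, L1.norm_eq_integral_norm]
    refine integral_congr_ae ?_
    filter_upwards [Lp.coeFn_sub (F n) G, (hf n).coeFn_toL1] with t h1 h2
    rw [h1, Pi.sub_apply, h2]
  have hc : CauchySeq F := by
    refine cauchySeq_of_summable_dist (hs.congr fun n => ?_)
    rw [hd]
    refine integral_congr_ae ?_
    filter_upwards [(hf (n + 1)).coeFn_toL1] with t h
    rw [h]
  obtain ⟨G, hG⟩ := cauchySeq_tendsto_of_complete hc
  refine ⟨G, L1.integrable_coeFn G, ?_⟩
  rw [tendsto_iff_dist_tendsto_zero] at hG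
  exact hG.congr (hd G)

/-! ### Dyadic blocks of solutions of `r' = c r²`. -/

section Algebra

variable {𝔸 : Type*} [NormedRing 𝔸] [NormedAlgebra ℂ 𝔸] {r : ℝ → 𝔸} {U : Set ℝ} {c : ℂ}

theorem iteratedDeriv_two_smul_of_riccati (hU : IsOpen U)
    (hr : ∀ s ∈ U, HasDerivAt r (c • (r s * r s)) s) {q q₁ q₂ : ℝ → ℂ}
    (hq : ∀ s, HasDerivAt q (q₁ s) s) (hq₁ : ∀ s, HasDerivAt q₁ (q₂ s) s) {s : ℝ} (hs : s ∈ U) :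
    iteratedDeriv 2 (fun x => q x • r x) s
      = q₂ s • r s + (2 * c * q₁ s) • (r s * r s) + (2 * c ^ 2 * q s) • (r s * r s * r s) := by
  have h1 : deriv (fun x => q x • r x) =ᶠ[𝓝 s]
      fun x => q x • (c • (r x * r x)) + q₁ x • r x := by
    filter_upwards [hU.mem_nhds hs] with x hx
    exact ((hq x).smul (hr x hx)).deriv
  rw [iteratedDeriv_succ, iteratedDeriv_one, h1.deriv_eq]
  have h2 := ((hq s).smul (((hr s hs).mul (hr s hs)).const_smul c)).add ((hq₁ s).smul (hr s hs))
  refine h2.deriv.trans ?_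
  simp only [Pi.smul_apply, Pi.mul_apply, smul_mul_assoc, mul_smul_comm, ← mul_assoc, smul_add, smul_smul]
  module

/-- The dyadic estimate: a solution of the Riccati equation of size `m` on `|s| ≥ ρ`, localized
to frequencies of size `ρ`, has an inverse Fourier transform of `L¹` norm `O(ρ m²)`. -/
theorem integral_norm_fourierInv_dyadic_le (hU : IsOpen U)
    (hr : ∀ s ∈ U, HasDerivAt r (c • (r s * r s)) s)
    (hrc : ∀ s ∈ U, ContDiffAt ℝ 2 r s) {q : ℝ → ℂ} (hq : ContDiff ℝ 2 q)
    (hq1 : ∀ x, |x| ≤ 1 → q x = 0) (hq4 : ∀ x, 4 ≤ |x| → q x = 0) {Q : ℝ}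
    (hQ0 : ∀ x, ‖q x‖ ≤ Q) (hQ1 : ∀ x, ‖deriv q x‖ ≤ Q) (hQ2 : ∀ x, ‖deriv (deriv q) x‖ ≤ Q)
    {ρ m : ℝ} (hρ : 0 < ρ) (hm : ρ⁻¹ ≤ m) (hρU : ∀ s, ρ ≤ |s| → s ∈ U)
    (hrm : ∀ s, ρ ≤ |s| → ‖r s‖ ≤ m) :
    ∫ t, ‖𝓕⁻ (fun s => q (s / ρ) • r s) t‖
      ≤ 4 * Real.pi * (4 * ρ * (Q * m * (2 * (1 + ‖c‖) * m))) := by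
  have hm0 : 0 < m := (inv_pos.2 hρ).trans_le hm
  have hQ : 0 ≤ Q := (norm_nonneg _).trans (hQ0 0)
  -- Below `ρ` the block vanishes identically, so the behaviour of `r` there, possibly singular, is
  -- irrelevant.
  have hz : ∀ s, ¬ ρ ≤ |s| → (fun s => q (s / ρ) • r s) =ᶠ[𝓝 s] fun _ => 0 := by
    intro s hs
    filter_upwards [(isOpen_lt continuous_abs continuous_const).mem_nhds (not_le.1 hs)] with x hx
    rw [hq1 _ (by rw [abs_div, abs_of_pos hρ, div_le_one hρ]; exact hx.le), zero_smul]
  have hd1 : Differentiable ℝ q := hq.differentiable two_ne_zero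
  have hd2 : Differentiable ℝ (deriv q) :=
    ((contDiff_succ_iff_deriv (n := 1)).1 hq).2.2.differentiable one_ne_zero
  have hsm : ∀ z : ℂ, (ρ⁻¹ : ℂ) * z = (1 / ρ) • z := fun z => by
    rw [Complex.real_smul]; push_cast; rw [one_div]
  have hs1 : ∀ s, HasDerivAt (fun s => q (s / ρ)) ((ρ⁻¹ : ℂ) * deriv q (s / ρ)) s := by
    intro s
    rw [hsm]
    exact (hd1 (s / ρ)).hasDerivAt.scomp s ((hasDerivAt_id s).div_const ρ)
  have hs2 : ∀ s, HasDerivAt (fun s => (ρ⁻¹ : ℂ) * deriv q (s / ρ))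
      ((ρ⁻¹ : ℂ) * ((ρ⁻¹ : ℂ) * deriv (deriv q) (s / ρ))) s := by
    intro s
    rw [hsm (deriv (deriv q) (s / ρ))]
    exact ((hd2 (s / ρ)).hasDerivAt.scomp s ((hasDerivAt_id s).div_const ρ)).const_mul (ρ⁻¹ : ℂ)
  have hnρ : ‖(ρ⁻¹ : ℂ)‖ ≤ m := by
    rw [norm_inv, Complex.norm_real, Real.norm_of_nonneg hρ.le]; exact hm
  -- Apply with support radius `4ρ`, `α = Qm` and `κ = 2(1 + ‖c‖)m`. Differentiating the cutoff
  -- costs `ρ⁻¹ ≤ m`, no more than differentiating `r`, so every term of the second derivative is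
  -- `O(Qm³)`, within `ακ²`.
  refine (integral_norm_fourierInv_le (by positivity) (by positivity) ?_ ?_ ?_ ?_).2
  · rw [contDiff_iff_contDiffAt]
    intro s
    by_cases hs : ρ ≤ |s|
    · exact ContDiffAt.smul (hq.comp (by fun_prop)).contDiffAt (hrc s (hρU s hs))
    · exact contDiffAt_const.congr_of_eventuallyEq (hz s hs)
  · intro s hs
    rw [hq4 _ (by rw [abs_div, abs_of_pos hρ, le_div_iff₀ hρ]; exact hs.le), zero_smul]
  · intro s
    by_cases hs : ρ ≤ |s|
    · rw [norm_smul]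
      exact mul_le_mul (hQ0 _) (hrm s hs) (norm_nonneg _) hQ
    · have h0 : q (s / ρ) • r s = 0 := (hz s hs).self_of_nhds
      rw [h0, norm_zero]
      positivity
  · intro s
    by_cases hs : ρ ≤ |s|
    · rw [iteratedDeriv_two_smul_of_riccati hU hr hs1 hs2 (hρU s hs)]
      have b1 := hrm s hs
      have b2 : ‖r s * r s‖ ≤ m * m := (norm_mul_le _ _).trans (by gcongr)
      have b3 : ‖r s * r s * r s‖ ≤ m * m * m := (norm_mul_le _ _).trans (by gcongr)
      calc _ ≤ ‖((ρ⁻¹ : ℂ) * ((ρ⁻¹ : ℂ) * deriv (deriv q) (s / ρ))) • r s‖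
            + ‖(2 * c * ((ρ⁻¹ : ℂ) * deriv q (s / ρ))) • (r s * r s)‖
            + ‖(2 * c ^ 2 * q (s / ρ)) • (r s * r s * r s)‖ := norm_add₃_le
        _ ≤ (m * (m * Q)) * m + (2 * ‖c‖ * (m * Q)) * (m * m)
            + (2 * ‖c‖ ^ 2 * Q) * (m * m * m) := by
          simp only [norm_smul, norm_mul, norm_pow, Complex.norm_ofNat]
          gcongr
          · exact hQ2 _
          · exact hQ1 _
          · exact hQ0 _
        _ = Q * m ^ 3 * (1 + 2 * ‖c‖ + 2 * ‖c‖ ^ 2) := by ring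
        _ ≤ Q * m ^ 3 * (4 * (1 + ‖c‖) ^ 2) := by
          gcongr
          nlinarith [norm_nonneg c]
        _ = _ := by ring
    · rw [(hz s hs).iteratedDeriv_eq 2]
      simp only [iteratedDeriv_const]
      simp
      positivity

end Algebra

variable {X : Type*} [NormedAddCommGroup X] [NormedSpace ℂ X]
  {A : X →ₗ.[ℂ] X}

/-- The resolvent along the imaginary axis, cut off near the spectrum and near infinity. -/
noncomputable def cutoffResolvent (A : X →ₗ.[ℂ] X) (χ η : ℝ → ℂ) (ρ s : ℝ) : X →L[ℂ] X :=
  (χ (s / ρ) - η s) • axisResolvent A s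

theorem hasCompactSupport_cutoffResolvent {χ η : ℝ → ℂ} (hχ2 : ∀ x, 2 ≤ |x| → χ x = 0)
    (hηs : HasCompactSupport η) {ρ : ℝ} (hρ : 0 < ρ) :
    HasCompactSupport (cutoffResolvent A χ η ρ) := by
  have h1 : HasCompactSupport fun s => χ (s / ρ) := by
    refine hasCompactSupport_of_abs (ρ := 2 * ρ) fun x hx => hχ2 _ ?_
    rw [abs_div, abs_of_pos hρ, le_div_iff₀ hρ]
    exact hx.le
  have h2 : HasCompactSupport fun s => χ (s / ρ) - η s := h1.sub hηs
  exact h2.smul_right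

variable [CompleteSpace X]

/-- A singular point `s` has `|s| < b ≤ ρ`, so `χ(·/ρ)` and `η` are both 1 near it and the cutoff
vanishes on a whole neighbourhood. -/
theorem contDiff_cutoffResolvent {χ η : ℝ → ℂ} (hχ : ContDiff ℝ ∞ χ)
    (hχ1 : ∀ x, |x| ≤ 1 → χ x = 1) (hη : ContDiff ℝ ∞ η)
    (hη1 : ∀ s ∉ axisRegular A, η =ᶠ[𝓝 s] fun _ => 1) {b ρ : ℝ} (hb : 0 < b) (hbρ : b ≤ ρ)
    (hbU : ∀ s, b ≤ |s| → s ∈ axisRegular A) : ContDiff ℝ 2 (cutoffResolvent A χ η ρ) := by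
  rw [contDiff_iff_contDiffAt]
  intro s
  by_cases hs : s ∈ axisRegular A
  · have h : ContDiff ℝ 2 fun s => χ (s / ρ) - η s :=
      ((hχ.of_le two_le_infty).comp (by fun_prop)).sub (hη.of_le two_le_infty)
    exact h.contDiffAt.smul (contDiffAt_axisResolvent hs)
  · have hs' : |s| < ρ := (not_le.1 (mt (hbU s) hs)).trans_le hbρ
    refine (contDiffAt_const (c := 0)).congr_of_eventuallyEq ?_
    filter_upwards [(isOpen_lt continuous_abs continuous_const).mem_nhds hs', hη1 s hs]
      with x hx hx'
    have hρ : 0 < ρ := hb.trans_le hbρ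
    rw [cutoffResolvent, hx', hχ1, sub_self, zero_smul]
    rw [abs_div, abs_of_pos hρ, div_le_one hρ]
    exact hx.le

/-- Consecutive truncations differ by one dyadic block, `η` cancelling out. The blocks have L¹ norm
`O(ρ m²)` with `m ~ ρ^(-θ)`, a geometric series of ratio `2^(1-2θ) < 1`. -/
theorem exists_kernel {χ η : ℝ → ℂ} (hχ : ContDiff ℝ ∞ χ)
    (hχ1 : ∀ x, |x| ≤ 1 → χ x = 1) (hχ2 : ∀ x, 2 ≤ |x| → χ x = 0) (hη : ContDiff ℝ ∞ η)
    (hηs : HasCompactSupport η) (hη1 : ∀ s ∉ axisRegular A, η =ᶠ[𝓝 s] fun _ => 1) {b : ℝ}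
    (hb : 0 < b) (hbU : ∀ s, b ≤ |s| → s ∈ axisRegular A) {θ C : ℝ} (hθ : 1 / 2 < θ) (hθ1 : θ ≤ 1)
    (hC : ∀ s, b ≤ |s| → ‖axisResolvent A s‖ ≤ C * |s| ^ (-θ)) :
    ∃ G : ℝ → X →L[ℂ] X, Integrable G ∧
      Tendsto (fun n : ℕ => ∫ t, ‖𝓕⁻ (cutoffResolvent A χ η (b * 2 ^ n)) t - G t‖) atTop
        (𝓝 0) := by
  have hρ : ∀ n : ℕ, 0 < b * 2 ^ n := fun n => by positivity
  have hbρ : ∀ n : ℕ, b ≤ b * 2 ^ n := fun n =>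
    le_mul_of_one_le_right hb.le (one_le_pow₀ one_le_two)
  have hd : ∀ n : ℕ, ContDiff ℝ 2 (cutoffResolvent A χ η (b * 2 ^ n)) := fun n =>
    contDiff_cutoffResolvent hχ hχ1 hη hη1 hb (hbρ n) hbU
  have hcs : ∀ n : ℕ, HasCompactSupport (cutoffResolvent A χ η (b * 2 ^ n)) := fun n =>
    hasCompactSupport_cutoffResolvent hχ2 hηs (hρ n)
  refine exists_tendsto_integral_norm_sub (fun n => integrable_fourierInv (hd n) (hcs n)) ?_
  let q : ℝ → ℂ := fun x => χ x - χ (x / 2)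
  have hq : ContDiff ℝ 2 q :=
    (hχ.of_le two_le_infty).sub ((hχ.of_le two_le_infty).comp (by fun_prop))
  have hq1 : ∀ x, |x| ≤ 1 → q x = 0 := fun x hx => by
    simp only [q]
    rw [hχ1 x hx, hχ1, sub_self]
    rw [abs_div, abs_two]; linarith
  have hq4 : ∀ x, 4 ≤ |x| → q x = 0 := fun x hx => by
    simp only [q]
    rw [hχ2 x (by linarith), hχ2, sub_self]
    rw [abs_div, abs_two]; linarith
  have hqs : HasCompactSupport q := hasCompactSupport_of_abs fun x hx => hq4 x hx.le
  obtain ⟨Q₀, hQ₀⟩ := hq.continuous.bounded_above_of_compact_support hqs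
  obtain ⟨Q₁, hQ₁⟩ := (hq.continuous_deriv one_le_two).bounded_above_of_compact_support hqs.deriv
  obtain ⟨Q₂, hQ₂⟩ := (((contDiff_succ_iff_deriv (n := 1)).1 hq).2.2.continuous_deriv
    le_rfl).bounded_above_of_compact_support hqs.deriv.deriv
  let Q := max Q₀ (max Q₁ Q₂)
  -- The second entry gives `ρ⁻¹ ≤ C' ρ^(-θ)` for all `ρ ≥ b`: as `θ ≤ 1`, `ρ^(θ-1) ≤ b^(θ-1)`.
  let C' := max C (b ^ (θ - 1))
  have hC' : 0 < C' := lt_max_of_lt_right (Real.rpow_pos_of_pos hb _)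
  let m : ℕ → ℝ := fun n => C' * (b * 2 ^ n) ^ (-θ)
  have hm : ∀ n, (b * 2 ^ n)⁻¹ ≤ m n := fun n => by
    calc (b * 2 ^ n)⁻¹ = (b * 2 ^ n) ^ (θ - 1) * (b * 2 ^ n) ^ (-θ) := by
          rw [← Real.rpow_add (hρ n), ← Real.rpow_neg_one]; congr 1; ring
      _ ≤ b ^ (θ - 1) * (b * 2 ^ n) ^ (-θ) := by
          refine mul_le_mul_of_nonneg_right ?_ (Real.rpow_pos_of_pos (hρ n) _).le
          exact Real.rpow_le_rpow_of_nonpos hb (hbρ n) (by linarith)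
      _ ≤ m n := mul_le_mul_of_nonneg_right (le_max_right _ _) (Real.rpow_pos_of_pos (hρ n) _).le
  have hrm : ∀ (n : ℕ) s, b * 2 ^ n ≤ |s| → ‖axisResolvent A s‖ ≤ m n := fun n s hs => by
    refine (hC s ((hbρ n).trans hs)).trans ?_
    refine mul_le_mul (le_max_left _ _) ?_ (Real.rpow_nonneg (abs_nonneg _) _) hC'.le
    exact Real.rpow_le_rpow_of_nonpos (hρ n) hs (by linarith)
  have key : ∀ n : ℕ, ∫ t, ‖𝓕⁻ (cutoffResolvent A χ η (b * 2 ^ n)) t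
      - 𝓕⁻ (cutoffResolvent A χ η (b * 2 ^ (n + 1))) t‖
      ≤ 4 * Real.pi * (4 * (b * 2 ^ n) * (Q * m n *
        (2 * (1 + ‖(-(2 * Real.pi * Complex.I) : ℂ)‖) * m n))) := by
    intro n
    have e : ∀ t, 𝓕⁻ (cutoffResolvent A χ η (b * 2 ^ n)) t
        - 𝓕⁻ (cutoffResolvent A χ η (b * 2 ^ (n + 1))) t
        = 𝓕⁻ (fun s => q (s / (b * 2 ^ n)) • axisResolvent A s) t := by
      intro t
      rw [← fourierInv_sub (integrable_of_contDiff (hd n) (hcs n))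
        (integrable_of_contDiff (hd (n + 1)) (hcs (n + 1)))]
      refine congrFun (congrArg _ (funext fun s => ?_)) t
      simp only [cutoffResolvent, q, ← sub_smul]
      rw [sub_sub_sub_cancel_right, div_div, pow_succ, mul_assoc]
    simp_rw [e]
    exact integral_norm_fourierInv_dyadic_le (isOpen_axisRegular A)
      (fun s hs => hasDerivAt_axisResolvent hs) (fun s hs => contDiffAt_axisResolvent hs) hq hq1 hq4
      (fun x => (hQ₀ x).trans (le_max_left _ _))
      (fun x => (hQ₁ x).trans ((le_max_left _ _).trans (le_max_right _ _)))
      (fun x => (hQ₂ x).trans ((le_max_right _ _).trans (le_max_right _ _))) (hρ n) (hm n)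
      (fun s hs => hbU s ((hbρ n).trans hs)) (hrm n)
  refine Summable.of_nonneg_of_le (fun n => integral_nonneg fun t => norm_nonneg _) key ?_
  have hgeo : Summable fun n : ℕ => ((2 : ℝ) ^ (1 - 2 * θ)) ^ n :=
    summable_geometric_of_lt_one (by positivity)
      (Real.rpow_lt_one_of_one_lt_of_neg one_lt_two (by linarith))
  refine (hgeo.mul_left (4 * Real.pi * (4 * (Q * (2 * (1 + ‖(-(2 * Real.pi * Complex.I) : ℂ)‖)) *
    C' ^ 2 * b ^ (1 - 2 * θ))))).congr fun n => ?_
  have h1 : ((2 : ℝ) ^ (1 - 2 * θ)) ^ n * b ^ (1 - 2 * θ)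
      = (b * 2 ^ n) * ((b * 2 ^ n) ^ (-θ) * (b * 2 ^ n) ^ (-θ)) := by
    rw [← Real.rpow_natCast, ← Real.rpow_mul zero_le_two, mul_comm (1 - 2 * θ),
      Real.rpow_mul zero_le_two, Real.rpow_natCast, ← Real.mul_rpow (by positivity) hb.le,
      mul_comm _ b, ← Real.rpow_add (hρ n)]
    nth_rw 2 [← Real.rpow_one (b * 2 ^ n)]
    rw [← Real.rpow_add (hρ n)]
    congr 1
    ring
  calc _ = 4 * Real.pi * (4 * (Q * (2 * (1 + ‖(-(2 * Real.pi * Complex.I) : ℂ)‖)) * C' ^ 2 *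
        (((2 : ℝ) ^ (1 - 2 * θ)) ^ n * b ^ (1 - 2 * θ)))) := by ring
    _ = _ := by rw [h1]; simp only [m]; ring

end Kernel
end NonResonance

namespace NonResonance

open scoped Convolution

/-! ### Invariant classes -/

section InvariantClass

variable {X : Type*} [NormedAddCommGroup X]

theorem IsBUC.add {α : Type*} [UniformSpace α] {f g : α → X} (hf : IsBUC f) (hg : IsBUC g) :
    IsBUC (f + g) := by
  obtain ⟨hf, C, hC⟩ := hf
  obtain ⟨hg, D, hD⟩ := hg
  exact ⟨hf.add hg, C + D, fun t => (norm_add_le _ _).trans (add_le_add (hC t) (hD t))⟩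

theorem IsBUC.zero {α : Type*} [UniformSpace α] : IsBUC (0 : α → X) :=
  ⟨uniformContinuous_const, 0, fun t => by simp⟩

theorem IsBUC.translate {f : ℝ → X} (hf : IsBUC f) (a : ℝ) : IsBUC fun t => f (a + t) := by
  obtain ⟨hf, C, hC⟩ := hf
  exact ⟨hf.comp (uniformContinuous_const.add uniformContinuous_id), C, fun t => hC _⟩

theorem IsBUC.domRestrict {f : ℝ → X} (hf : IsBUC f) (J : Set ℝ) : IsBUC (J.domRestrict f) := by
  obtain ⟨hf, C, hC⟩ := hf
  exact ⟨hf.comp uniformContinuous_subtype_val, C, fun t => hC _⟩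

theorem IsBUC.exists_essBoundedBy {f : ℝ → X} (hf : IsBUC f) : ∃ M, EssBoundedBy f M := by
  obtain ⟨hf, C, hC⟩ := hf
  exact ⟨C, .of_continuous hf.continuous hC⟩

variable [NormedSpace ℂ X]

theorem IsBUC.clm_comp {α : Type*} [UniformSpace α] {f : α → X} (hf : IsBUC f) (B : X →L[ℂ] X) :
    IsBUC fun t => B (f t) := by
  obtain ⟨hf, C, hC⟩ := hf
  refine ⟨B.uniformContinuous.comp hf, ‖B‖ * C, fun t => (B.le_opNorm _).trans ?_⟩
  gcongr
  exact hC t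

theorem IsBUC.const_smul {α : Type*} [UniformSpace α] {f : α → X} (hf : IsBUC f) (c : ℂ) :
    IsBUC fun t => c • f t :=
  hf.clm_comp (c • ContinuousLinearMap.id ℂ X)

theorem isBUC_convolution {E E' : Type*} [NormedAddCommGroup E] [NormedAddCommGroup E']
    [NormedSpace ℂ E] [NormedSpace ℂ E'] (B : E →L[ℂ] E' →L[ℂ] X) {f : ℝ → E} {φ : ℝ → E'} {M : ℝ}
    (hf : Integrable f) (hφ : EssBoundedBy φ M) : IsBUC (f ⋆[B] φ) :=
  ⟨uniformContinuous_convolution B hf hφ, _, norm_convolution_le B hf hφ⟩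

variable {J : Set ℝ} {𝓕 : Submodule ℂ (J → X)}

theorem IsInvariantClass.mem_of_forall_exists_norm_sub_le (h𝓕 : IsInvariantClass 𝓕) {g : ℝ → X}
    (hg : ∀ ε > 0, ∃ f : ℝ → X, IsBUC f ∧ J.domRestrict f ∈ 𝓕 ∧ ∀ t, ‖f t - g t‖ ≤ ε) :
    J.domRestrict g ∈ 𝓕 := by
  choose f hf1 hf2 hf3 using fun n : ℕ => hg (1 / ((n : ℝ) + 1)) Nat.one_div_pos_of_nat
  refine h𝓕.uniformLimit (fun n => J.domRestrict (f n)) _ hf2 (fun n => (hf1 n).domRestrict J) ?_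
  rw [Metric.tendstoUniformly_iff]
  intro ε hε
  filter_upwards [tendsto_one_div_add_atTop_nhds_zero_nat.eventually (gt_mem_nhds hε)] with n hn t
  rw [dist_comm, dist_eq_norm]
  exact (hf3 n t).trans_lt hn

/-- Invariant classes are stable under convolution with operator-valued integrable kernels. -/
theorem IsInvariantClass.convolution_mem (h𝓕 : IsInvariantClass 𝓕) {ψ : ℝ → X} (hψ : IsBUC ψ)
    (hψ𝓕 : J.domRestrict ψ ∈ 𝓕) {G : ℝ → X →L[ℂ] X} (hG : Integrable G) :
    J.domRestrict (G ⋆[ContinuousLinearMap.id ℂ (X →L[ℂ] X)] ψ) ∈ 𝓕 := by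
  obtain ⟨M, hM⟩ := hψ.2
  have hM0 : 0 ≤ M := (norm_nonneg _).trans (hM 0)
  have hψb : EssBoundedBy ψ M := .of_continuous hψ.1.continuous hM
  have hint : ∀ t, Integrable fun s => G s (ψ (t - s)) := fun t =>
    convolutionExistsAt_of_essBoundedBy (ContinuousLinearMap.id ℂ (X →L[ℂ] X)) hG hψb t
  refine h𝓕.mem_of_forall_exists_norm_sub_le fun ε hε => ?_
  set I := ∫ s, ‖G s‖ with hI
  have hI0 : 0 ≤ I := integral_nonneg fun s => norm_nonneg _
  -- Half of `ε` goes to the Riemann sum on `[-N, N]`, half to the tail of `G`; `I + 1` and `M + 1`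
  -- avoid division by zero.
  obtain ⟨δ, hδ, hψδ⟩ := Metric.uniformContinuous_iff.1 hψ.1 (ε / 2 / (I + 1)) (by positivity)
  have hlim := intervalIntegral_tendsto_integral hG.norm
    (tendsto_neg_atTop_atBot.comp tendsto_natCast_atTop_atTop)
    (tendsto_natCast_atTop_atTop (R := ℝ))
  have htail : ∀ᶠ n : ℕ in atTop, I - ε / 2 / (M + 1) < ∫ s in (-(n : ℝ))..n, ‖G s‖ :=
    hlim.eventually (lt_mem_nhds (by rw [← hI]; linarith [show 0 < ε / 2 / (M + 1) by positivity]))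
  obtain ⟨N, hN⟩ := htail.exists
  obtain ⟨k, hk⟩ := exists_nat_gt ((2 * N : ℝ) / δ)
  have hk0 : (0 : ℝ) < k := lt_of_le_of_lt (by positivity) hk
  let x : ℕ → ℝ := fun j => -N + j * (2 * N / k)
  have hxs : ∀ j, x j ≤ x (j + 1) := fun j => by
    simp only [x]; push_cast; nlinarith [show (0 : ℝ) ≤ 2 * N / k by positivity]
  have hxd : ∀ j, x (j + 1) - x j < δ := fun j => by
    have : x (j + 1) - x j = 2 * N / k := by simp only [x]; push_cast; ring
    rw [this, div_lt_iff₀ hk0]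
    rw [div_lt_iff₀ hδ] at hk
    linarith [mul_comm δ (k : ℝ)]
  have hx0 : x 0 = -N := by simp [x]
  have hxk : x k = N := by simp only [x]; field_simp; ring
  -- On each cell only `ψ` is frozen, at `t - x j`, while `G` is integrated. Each term is thus a
  -- bounded operator applied to a translate of `ψ`, which the axioms of `𝓕` allow.
  let P : ℕ → ℝ → X := fun j t => (∫ s in (x j)..(x (j + 1)), G s) (ψ (-x j + t))
  have hP : IsBUC (∑ j ∈ Finset.range k, P j) ∧ J.domRestrict (∑ j ∈ Finset.range k, P j) ∈ 𝓕 := by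
    refine Finset.sum_induction P (fun f => IsBUC f ∧ J.domRestrict f ∈ 𝓕)
      (fun f g hf hg => ⟨hf.1.add hg.1, 𝓕.add_mem hf.2 hg.2⟩) ⟨IsBUC.zero, 𝓕.zero_mem⟩
      fun j _ => ?_
    exact ⟨(hψ.translate _).clm_comp _,
      h𝓕.comp _ (hψ.translate _) (h𝓕.translate ψ hψ hψ𝓕 (-x j)) _⟩
  refine ⟨_, hP.1, hP.2, fun t => ?_⟩
  have hPj : ∀ j, ‖P j t - ∫ s in (x j)..(x (j + 1)), G s (ψ (t - s))‖
      ≤ ε / 2 / (I + 1) * ∫ s in (x j)..(x (j + 1)), ‖G s‖ := by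
    intro j
    have hGi : IntervalIntegrable G volume (x j) (x (j + 1)) := hG.intervalIntegrable
    have e1 : P j t = ∫ s in (x j)..(x (j + 1)), G s (ψ (-x j + t)) :=
      ContinuousLinearMap.intervalIntegral_apply hGi _
    have hc : IntervalIntegrable (fun s => G s (ψ (-x j + t))) volume (x j) (x (j + 1)) :=
      (hG.apply_continuousLinearMap _).intervalIntegrable
    rw [e1, ← intervalIntegral.integral_sub hc (hint t).intervalIntegrable,
      ← intervalIntegral.integral_const_mul]
    refine intervalIntegral.norm_integral_le_of_norm_le (hxs j) (.of_forall fun s hs => ?_)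
      (hG.norm.const_mul _).intervalIntegrable
    rw [← map_sub]
    refine (ContinuousLinearMap.le_opNorm _ _).trans ?_
    rw [mul_comm]
    gcongr
    rw [← dist_eq_norm]
    refine (hψδ ?_).le
    rw [Real.dist_eq, show -x j + t - (t - s) = s - x j by ring, abs_of_pos (sub_pos.2 hs.1)]
    linarith [hs.2, hxd j]
  have hsumP : ‖(∑ j ∈ Finset.range k, P j) t - ∫ s in (-(N : ℝ))..N, G s (ψ (t - s))‖ ≤ ε / 2 := by
    have h1 := intervalIntegral.sum_integral_adjacent_intervals (a := x) (n := k)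
      (f := fun s => G s (ψ (t - s))) (μ := volume) fun j _ => (hint t).intervalIntegrable
    have h2 := intervalIntegral.sum_integral_adjacent_intervals (a := x) (n := k)
      (f := fun s => ‖G s‖) (μ := volume) fun j _ => hG.norm.intervalIntegrable
    rw [hx0, hxk] at h1 h2
    rw [← h1, Finset.sum_apply, ← Finset.sum_sub_distrib]
    refine (norm_sum_le_of_le _ fun j _ => hPj j).trans ?_
    rw [← Finset.mul_sum, h2]
    have h3 : ∫ s in (-(N : ℝ))..N, ‖G s‖ ≤ I := by
      rw [intervalIntegral.integral_of_le (by linarith [(Nat.cast_nonneg N : (0 : ℝ) ≤ N)])]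
      exact setIntegral_le_integral hG.norm (.of_forall fun s => norm_nonneg _)
    calc _ ≤ ε / 2 / (I + 1) * (I + 1) := by gcongr; linarith
      _ = ε / 2 := by field_simp
  have htl : ‖(∫ s in (-(N : ℝ))..N, G s (ψ (t - s))) - ∫ s, G s (ψ (t - s))‖ ≤ ε / 2 := by
    have hNN : -(N : ℝ) ≤ N := by linarith [(Nat.cast_nonneg N : (0 : ℝ) ≤ N)]
    rw [intervalIntegral.integral_of_le hNN] at hN ⊢
    have h1 := integral_add_compl (measurableSet_Ioc (a := -(N : ℝ)) (b := N)) (hint t)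
    have h2 := integral_add_compl (measurableSet_Ioc (a := -(N : ℝ)) (b := N)) hG.norm
    rw [← h1, sub_add_cancel_left, norm_neg]
    calc _ ≤ ∫ s in (Ioc (-(N : ℝ)) N)ᶜ, M * ‖G s‖ := by
          refine norm_integral_le_of_norm_le (hG.norm.const_mul _).integrableOn
            (.of_forall fun s => (ContinuousLinearMap.le_opNorm _ _).trans ?_)
          rw [mul_comm]
          gcongr
          exact hM _
      _ = M * ∫ s in (Ioc (-(N : ℝ)) N)ᶜ, ‖G s‖ := integral_const_mul _ _
      _ ≤ (M + 1) * (ε / 2 / (M + 1)) :=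
          mul_le_mul (by linarith) (by linarith) (integral_nonneg fun s => norm_nonneg _)
            (by linarith)
      _ = ε / 2 := by field_simp
  calc _ = ‖((∑ j ∈ Finset.range k, P j) t - ∫ s in (-(N : ℝ))..N, G s (ψ (t - s)))
        + ((∫ s in (-(N : ℝ))..N, G s (ψ (t - s))) - ∫ s, G s (ψ (t - s)))‖ := by
        rw [sub_add_sub_cancel]; rfl
    _ ≤ ε / 2 + ε / 2 := (norm_add_le _ _).trans (add_le_add hsumP htl)
    _ = ε := add_halves ε

/-! ### Means as box convolutions, and mean classes. -/

variable [CompleteSpace X]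

/-- The indicator function of `(-h, 0]`. -/
noncomputable def boxKernel (h : ℝ) : ℝ → ℂ := (Ioc (-h) 0).indicator fun _ => 1

theorem integrable_boxKernel (h : ℝ) : Integrable (boxKernel h) :=
  (integrable_indicator_iff measurableSet_Ioc).2 (integrableOn_const (by simp))

theorem boxKernel_convolution {E : Type*} [NormedAddCommGroup E] [NormedSpace ℂ E] {h : ℝ}
    (hh : 0 ≤ h) (φ : ℝ → E) (t : ℝ) :
    (boxKernel h ⋆[ContinuousLinearMap.lsmul ℂ ℂ] φ) t = ∫ s in (0 : ℝ)..h, φ (t + s) := by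
  have h1 := intervalIntegral.integral_comp_neg (a := -h) (b := 0) fun s => φ (t + s)
  rw [neg_zero, neg_neg] at h1
  rw [← h1, intervalIntegral.integral_of_le (by linarith), convolution_def,
    ← integral_indicator measurableSet_Ioc]
  congr 1 with s
  by_cases hs : s ∈ Ioc (-h) 0 <;> simp [boxKernel, hs, sub_eq_add_neg]

/-- Operator kernels need not commute with one another, but scalar ones commute with them; after
reassociation this is a flip. -/
theorem convolution_comm_scalar {G : ℝ → X →L[ℂ] X} (hG : Integrable G) {m : ℝ → ℂ}
    (hm : Integrable m) {φ : ℝ → X} {M : ℝ} (hφ : EssBoundedBy φ M) (t : ℝ) :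
    (G ⋆[ContinuousLinearMap.id ℂ (X →L[ℂ] X)] (m ⋆[ContinuousLinearMap.lsmul ℂ ℂ] φ)) t
      = (m ⋆[ContinuousLinearMap.lsmul ℂ ℂ]
        (G ⋆[ContinuousLinearMap.id ℂ (X →L[ℂ] X)] φ)) t := by
  rw [← convolution_assoc_of_essBoundedBy
      (ContinuousLinearMap.lsmul ℂ ℂ : ℂ →L[ℂ] (X →L[ℂ] X) →L[ℂ] (X →L[ℂ] X)).flip
      (ContinuousLinearMap.id ℂ (X →L[ℂ] X)) (ContinuousLinearMap.id ℂ (X →L[ℂ] X))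
      (ContinuousLinearMap.lsmul ℂ ℂ) (fun x y z => by simp) hG hm hφ,
    ← convolution_assoc_of_essBoundedBy (ContinuousLinearMap.lsmul ℂ ℂ)
      (ContinuousLinearMap.id ℂ (X →L[ℂ] X)) (ContinuousLinearMap.lsmul ℂ ℂ)
      (ContinuousLinearMap.id ℂ (X →L[ℂ] X)) (fun x y z => by simp) hm hG hφ,
    convolution_flip]

/-- `φ` need not lie in `𝓕`, but its means do and are BUC. By commutation the means of `u = G ⋆ φ`
lie in `𝓕`, and they tend uniformly to `u` as the averaging length tends to 0. -/
theorem IsInvariantClass.convolution_mem_of_mem_meanClass (h𝓕 : IsInvariantClass 𝓕)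
    (hJ : J = univ ∨ J = Ici 0) {φ : ℝ → X} {M : ℝ} (hφ : EssBoundedBy φ M)
    (hφ𝓕 : J.domRestrict φ ∈ meanClass (𝓕 : Set (J → X))) {G : ℝ → X →L[ℂ] X}
    (hG : Integrable G) :
    J.domRestrict (G ⋆[ContinuousLinearMap.id ℂ (X →L[ℂ] X)] φ) ∈ 𝓕 := by
  -- Forward averages never leave `J`, so the extension by zero in `mean` agrees with `φ` wherever
  -- it is evaluated.
  have hJadd : ∀ t ∈ J, ∀ s, 0 ≤ s → t + s ∈ J := by
    rcases hJ with rfl | rfl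
    · simp
    · intro t ht s hs
      exact add_nonneg ht hs
  have hmean : ∀ h : ℝ, 0 < h →
      J.domRestrict (boxKernel h ⋆[ContinuousLinearMap.lsmul ℂ ℂ] φ) ∈ 𝓕 := by
    intro h hh
    have e : J.domRestrict (boxKernel h ⋆[ContinuousLinearMap.lsmul ℂ ℂ] φ)
        = (h : ℂ) • mean h (J.domRestrict φ) := by
      ext t
      have hh' : (h : ℂ) ≠ 0 := by exact_mod_cast hh.ne'
      simp only [Pi.smul_apply, mean, Complex.ofReal_inv, smul_inv_smul₀ hh', Set.domRestrict_apply,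
        boxKernel_convolution hh.le]
      refine intervalIntegral.integral_congr fun s hs => ?_
      rw [uIcc_of_le hh.le] at hs
      exact (Subtype.val_injective.extend_apply (J.domRestrict φ) 0
        ⟨t + s, hJadd t t.2 s hs.1⟩).symm
    rw [e]
    exact 𝓕.smul_mem _ (hφ𝓕.2 h hh)
  set u := G ⋆[ContinuousLinearMap.id ℂ (X →L[ℂ] X)] φ with hu
  have huB : IsBUC u := isBUC_convolution _ hG hφ
  obtain ⟨M', hM'⟩ := huB.exists_essBoundedBy
  have hGm : ∀ h : ℝ, 0 < h →
      J.domRestrict (boxKernel h ⋆[ContinuousLinearMap.lsmul ℂ ℂ] u) ∈ 𝓕 := by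
    intro h hh
    have e : boxKernel h ⋆[ContinuousLinearMap.lsmul ℂ ℂ] u
        = G ⋆[ContinuousLinearMap.id ℂ (X →L[ℂ] X)]
          (boxKernel h ⋆[ContinuousLinearMap.lsmul ℂ ℂ] φ) :=
      funext fun t => (convolution_comm_scalar hG (integrable_boxKernel h) hφ t).symm
    rw [e]
    exact h𝓕.convolution_mem (isBUC_convolution _ (integrable_boxKernel h) hφ) (hmean h hh) hG
  refine h𝓕.mem_of_forall_exists_norm_sub_le fun ε hε => ?_
  obtain ⟨δ, hδ, huδ⟩ := Metric.uniformContinuous_iff.1 huB.1 ε hε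
  have hδ2 : 0 < δ / 2 := half_pos hδ
  refine ⟨fun t => ((δ / 2 : ℝ) : ℂ)⁻¹ •
    (boxKernel (δ / 2) ⋆[ContinuousLinearMap.lsmul ℂ ℂ] u) t,
    (isBUC_convolution _ (integrable_boxKernel _) hM').const_smul _,
    𝓕.smul_mem _ (hGm _ hδ2), fun t => ?_⟩
  have hc : ∀ t, IntervalIntegrable (fun s => u (t + s)) volume 0 (δ / 2) := fun t =>
    (huB.1.continuous.comp (continuous_const.add continuous_id)).intervalIntegrable _ _
  have e : ((δ / 2 : ℝ) : ℂ)⁻¹ • (boxKernel (δ / 2) ⋆[ContinuousLinearMap.lsmul ℂ ℂ] u) t - u t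
      = ((δ / 2 : ℝ) : ℂ)⁻¹ • ∫ s in (0 : ℝ)..(δ / 2), (u (t + s) - u t) := by
    have h0 : ((δ / 2 : ℝ) : ℂ) ≠ 0 := by exact_mod_cast hδ2.ne'
    rw [boxKernel_convolution hδ2.le, intervalIntegral.integral_sub (hc t) (by simp),
      intervalIntegral.integral_const, sub_zero, smul_sub, ← Complex.coe_smul (δ / 2),
      inv_smul_smul₀ h0]
  rw [e, norm_smul, norm_inv, Complex.norm_real, Real.norm_of_nonneg hδ2.le, inv_mul_le_iff₀ hδ2]
  refine (intervalIntegral.norm_integral_le_of_norm_le_const (C := ε) fun s hs => ?_).trans ?_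
  · rw [uIoc_of_le hδ2.le] at hs
    rw [← dist_eq_norm]
    refine (huδ ?_).le
    rw [Real.dist_eq, add_sub_cancel_left, abs_of_pos hs.1]
    linarith [hs.2]
  · rw [sub_zero, abs_of_pos hδ2, mul_comm]

end InvariantClass
end NonResonance

namespace NonResonance

open scoped Convolution FourierTransform ContDiff Manifold

/-! ### Mild solutions -/

section MildSolution

variable {X : Type*} [NormedAddCommGroup X] [NormedSpace ℂ X] {A : X →ₗ.[ℂ] X}

/-- The hypothesis reads `W = R y` for `W = ∫u`. Hence `W ∈ D(A)` and `AW = zW - y`, which unwinds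
to the mild equation. -/
theorem IsResolventAt.isMildSolution {z : ℂ} {R : X →L[ℂ] X} (hR : IsResolventAt A z R)
    {φ u : ℝ → X} (hu : Continuous u)
    (h : ∀ t, ∫ s in (0 : ℝ)..t, u s =
      R (z • (∫ s in (0 : ℝ)..t, u s) + (∫ s in (0 : ℝ)..t, φ s) - (u t - u 0))) :
    IsMildSolution A φ u := by
  refine ⟨hu, fun t => ?_⟩
  set y := z • (∫ s in (0 : ℝ)..t, u s) + (∫ s in (0 : ℝ)..t, φ s) - (u t - u 0) with hy
  obtain ⟨hd, he⟩ := hR.1 y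
  have hW : ∫ s in (0 : ℝ)..t, u s = R y := h t
  refine ⟨hW ▸ hd, ?_⟩
  have hA : A ⟨∫ s in (0 : ℝ)..t, u s, hW ▸ hd⟩ = A ⟨R y, hd⟩ := by
    congr 2
  have h1 : A ⟨R y, hd⟩ = z • R y - y := 
    eq_sub_of_add_eq' (sub_eq_iff_eq_add.1 he).symm
  rw [hA, h1, ← hW, hy]
  abel

/-- This is the resolvent identity between `R` and `r(s)` times the scalar cutoff; at singular `s`
both sides vanish. The factor `2πis` will become a time derivative, and unbounded `A` enters only
through `R`. -/
theorem cutoffResolvent_identity {z : ℂ} {R : X →L[ℂ] X} (hR : IsResolventAt A z R)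
    {χ η : ℝ → ℂ} (hχ1 : ∀ x, |x| ≤ 1 → χ x = 1)
    (hη1 : ∀ s ∉ axisRegular A, η s = 1) {ρ : ℝ} (hρ : 0 < ρ)
    (hρU : ∀ s, ρ ≤ |s| → s ∈ axisRegular A) (s : ℝ) :
    R * ((2 * Real.pi * Complex.I * s : ℂ) • cutoffResolvent A χ η ρ s)
      + (cutoffResolvent A χ η ρ s - z • (R * cutoffResolvent A χ η ρ s))
      = (χ (s / ρ) - η s) • R := by
  by_cases hs : s ∈ axisRegular A
  · have h1 := axisResolvent_identity hs hR
    have h2 : R = axisResolvent A s + (2 * Real.pi * Complex.I * s - z) •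
      (R * axisResolvent A s) := by rw [← h1]; abel
    conv_rhs => rw [h2]
    simp only [cutoffResolvent, mul_smul_comm]
    module
  · have hs' : |s| ≤ ρ := (not_le.1 (mt (hρU s) hs)).le
    have h1 : χ (s / ρ) = 1 := hχ1 _ (by rwa [abs_div, abs_of_pos hρ, div_le_one hρ])
    simp [cutoffResolvent, h1, hη1 s hs]

/-- Solutions of the regularized equation, on intervals with arbitrary left end point. -/
theorem IsResolventAt.isMildSolution_of_translate {z : ℂ} {R : X →L[ℂ] X}
    (hR : IsResolventAt A z R) {φ u : ℝ → X} (hu : Continuous u)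
    (h : ∀ t l : ℝ, 0 ≤ l → R (u (t + l) - u t) + ((∫ s in (0 : ℝ)..l, u (t + s))
      - z • R (∫ s in (0 : ℝ)..l, u (t + s))) = R (∫ s in (0 : ℝ)..l, φ (t + s))) :
    IsMildSolution A φ u := by
  refine hR.isMildSolution hu fun t => ?_
  rw [map_sub, map_add, map_smul]
  rcases le_total 0 t with ht | ht
  · have := h 0 t ht
    simp only [zero_add] at this
    rw [← this]
    abel
  · have h1 := h t (-t) (by linarith)
    rw [add_neg_cancel, intervalIntegral.integral_comp_add_left (f := u),
      intervalIntegral.integral_comp_add_left (f := φ), add_zero, add_neg_cancel,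
      intervalIntegral.integral_symm 0 t, intervalIntegral.integral_symm 0 t] at h1
    simp only [map_neg, smul_neg, map_sub] at h1 ⊢
    rw [← neg_eq_iff_eq_neg] at h1
    rw [← h1]
    abel

variable [CompleteSpace X]

variable {φ : ℝ → X} {M : ℝ}

theorem scalar_convolution_comm (f g : ℝ → ℂ) :
    f ⋆[ContinuousLinearMap.lsmul ℂ ℂ] g = g ⋆[ContinuousLinearMap.lsmul ℂ ℂ] f := by
  rw [← convolution_flip]
  congr 1
  ext
  simp

/-- The fundamental theorem of calculus is applied to the kernel, giving `g(· + l) - g`, so `g ⋆ φ`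
itself is never differentiated. -/
theorem boxKernel_convolution_deriv {g g' : ℝ → X →L[ℂ] X} (hg : Integrable g)
    (hg' : Integrable g') (hgc : Continuous g') (hd : ∀ t, HasDerivAt g (g' t) t)
    (hφ : EssBoundedBy φ M) {l : ℝ} (hl : 0 ≤ l) (t : ℝ) :
    (boxKernel l ⋆[ContinuousLinearMap.lsmul ℂ ℂ]
      (g' ⋆[ContinuousLinearMap.id ℂ (X →L[ℂ] X)] φ)) t
      = (g ⋆[ContinuousLinearMap.id ℂ (X →L[ℂ] X)] φ) (t + l)
        - (g ⋆[ContinuousLinearMap.id ℂ (X →L[ℂ] X)] φ) t := by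
  rw [← convolution_assoc_of_essBoundedBy (ContinuousLinearMap.lsmul ℂ ℂ)
      (ContinuousLinearMap.id ℂ (X →L[ℂ] X)) (ContinuousLinearMap.lsmul ℂ ℂ)
      (ContinuousLinearMap.id ℂ (X →L[ℂ] X)) (fun x y z => by simp) (integrable_boxKernel l) hg' hφ]
  have e : boxKernel l ⋆[ContinuousLinearMap.lsmul ℂ ℂ] g' = fun s => g (s + l) - g s := by
    ext1 s
    rw [boxKernel_convolution hl, intervalIntegral.integral_comp_add_left (f := g'), add_zero]
    exact intervalIntegral.integral_eq_sub_of_hasDerivAt (fun x _ => hd x)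
      (hgc.intervalIntegrable _ _)
  rw [e, convolution_sub_left _ (hg.comp_add_right l) hg hφ]
  congr 1
  rw [convolution_def, convolution_def]
  conv_rhs => rw [← integral_add_right_eq_self _ l]
  simp only [add_sub_add_right_eq_sub]

theorem contDiff_two_pi_I_smul {E : Type*} [NormedAddCommGroup E] [NormedSpace ℂ E] {H : ℝ → E}
    (hH : ContDiff ℝ 2 H) : ContDiff ℝ 2 fun x : ℝ => (2 * Real.pi * Complex.I * x : ℂ) • H x := by
  have h : ContDiff ℝ 2 fun x : ℝ => (2 * Real.pi * Complex.I * x : ℂ) :=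
    contDiff_const.mul Complex.ofRealCLM.contDiff
  exact h.smul hH

theorem hasCompactSupport_two_pi_I_smul {E : Type*} [NormedAddCommGroup E] [NormedSpace ℂ E]
    {H : ℝ → E} (hH : HasCompactSupport H) :
    HasCompactSupport fun x : ℝ => (2 * Real.pi * Complex.I * x : ℂ) • H x :=
  HasCompactSupport.smul_left (f := fun x : ℝ => (2 * Real.pi * Complex.I * x : ℂ)) hH

theorem contDiff_comp_div {χ : ℝ → ℂ} (hχ : ContDiff ℝ ∞ χ) (ρ : ℝ) :
    ContDiff ℝ 2 fun s => χ (s / ρ) :=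
  (hχ.of_le two_le_infty).comp (by fun_prop)

theorem hasCompactSupport_comp_div {χ : ℝ → ℂ} (hχ2 : ∀ x, 2 ≤ |x| → χ x = 0) {ρ : ℝ}
    (hρ : 0 < ρ) : HasCompactSupport fun s => χ (s / ρ) := by
  refine hasCompactSupport_of_abs (ρ := 2 * ρ) fun x hx => hχ2 _ ?_
  rw [abs_div, abs_of_pos hρ, le_div_iff₀ hρ]
  exact hx.le

theorem fourierInv_cutoffResolvent_identity {z : ℂ} {R : X →L[ℂ] X} {χ η : ℝ → ℂ}
    {H H' : ℝ → X →L[ℂ] X} (iH : Integrable H) (iH' : Integrable H') (iχ : Integrable χ)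
    (iη : Integrable η) (h : ∀ s, R * H' s + (H s - z • (R * H s)) = (χ s - η s) • R) (s : ℝ) :
    R * 𝓕⁻ H' s + (𝓕⁻ H s - z • (R * 𝓕⁻ H s)) = (𝓕⁻ χ s - 𝓕⁻ η s) • R := by
  let mR : (X →L[ℂ] X) →L[ℂ] (X →L[ℂ] X) := ContinuousLinearMap.mul ℂ (X →L[ℂ] X) R
  have a1 : R * 𝓕⁻ H' s = 𝓕⁻ (fun x => R * H' x) s := (fourierInv_clm mR iH' s).symm
  have a2 : z • (R * 𝓕⁻ H s) = 𝓕⁻ (fun x => z • (R * H x)) s :=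
    (fourierInv_clm (z • mR) iH s).symm
  have a3 : (𝓕⁻ χ s - 𝓕⁻ η s) • R = 𝓕⁻ (fun x => (χ x - η x) • R) s := by
    rw [← fourierInv_sub iχ iη]
    exact (fourierInv_clm ((ContinuousLinearMap.lsmul ℂ ℂ).flip R) (iχ.sub iη) s).symm
  have i1 : Integrable fun x => R * H' x := mR.integrable_comp iH'
  have i2 : Integrable fun x => z • (R * H x) := (z • mR).integrable_comp iH
  have i3 : Integrable fun x => H x - z • (R * H x) := iH.sub i2
  rw [a1, a2, a3, ← fourierInv_sub iH i2, ← fourierInv_add i1 i3]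
  simp_rw [h]

theorem convolution_identity {z : ℂ} {R : X →L[ℂ] X} {g g' : ℝ → X →L[ℂ] X} {e f : ℝ → ℂ}
    (hg : Integrable g) (hg' : Integrable g') (he : Integrable e) (hf : Integrable f)
    (h : ∀ s, R * g' s + (g s - z • (R * g s)) = (e s - f s) • R) (hφ : EssBoundedBy φ M)
    (hfφ : ∀ t, (f ⋆[ContinuousLinearMap.lsmul ℂ ℂ] φ) t = 0) (x : ℝ) :
    R ((g' ⋆[ContinuousLinearMap.id ℂ (X →L[ℂ] X)] φ) x)
      + ((g ⋆[ContinuousLinearMap.id ℂ (X →L[ℂ] X)] φ) x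
        - z • R ((g ⋆[ContinuousLinearMap.id ℂ (X →L[ℂ] X)] φ) x))
      = R ((e ⋆[ContinuousLinearMap.lsmul ℂ ℂ] φ) x) := by
  have cg : Integrable fun s => g s (φ (x - s)) :=
    convolutionExistsAt_of_essBoundedBy (ContinuousLinearMap.id ℂ (X →L[ℂ] X)) hg hφ x
  have cg' : Integrable fun s => g' s (φ (x - s)) :=
    convolutionExistsAt_of_essBoundedBy (ContinuousLinearMap.id ℂ (X →L[ℂ] X)) hg' hφ x
  have ce : Integrable fun s => e s • φ (x - s) :=
    convolutionExistsAt_of_essBoundedBy (ContinuousLinearMap.lsmul ℂ ℂ) he hφ x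
  have cf : Integrable fun s => f s • φ (x - s) :=
    convolutionExistsAt_of_essBoundedBy (ContinuousLinearMap.lsmul ℂ ℂ) hf hφ x
  have cRg := R.integrable_comp cg
  have cRg' := R.integrable_comp cg'
  have cRz : Integrable fun s => z • R (g s (φ (x - s))) := cRg.smul z
  have cgz : Integrable fun s => g s (φ (x - s)) - z • R (g s (φ (x - s))) := cg.sub cRz
  have cef : Integrable fun s => e s • φ (x - s) - f s • φ (x - s) := ce.sub cf
  have h0 : ∫ s, f s • φ (x - s) = 0 := hfφ x
  change R (∫ s, g' s (φ (x - s))) + ((∫ s, g s (φ (x - s))) - z • R (∫ s, g s (φ (x - s))))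
    = R (∫ s, e s • φ (x - s))
  rw [← sub_zero (∫ s, e s • φ (x - s)), ← h0, ← integral_sub ce cf, ← R.integral_comp_comm cg',
    ← R.integral_comp_comm cg, ← R.integral_comp_comm cef, ← integral_smul,
    ← integral_sub cg cRz, ← integral_add cRg' cgz]
  congr 1 with s
  have := congrArg (fun T : X →L[ℂ] X => T (φ (x - s))) (h s)
  simpa [sub_smul] using this

/-- Integrate `convolution_identity` over `[t, t + l]`. On the right the box is moved onto `φ`, so
that the approximate identity `e` later acts on a continuous function. -/
theorem regularized_equation {z : ℂ} {R : X →L[ℂ] X} {g g' : ℝ → X →L[ℂ] X} {e f : ℝ → ℂ}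
    (hg : Integrable g) (hg' : Integrable g') (he : Integrable e) (hf : Integrable f)
    (hgc : Continuous g') (hd : ∀ t, HasDerivAt g (g' t) t)
    (h : ∀ s, R * g' s + (g s - z • (R * g s)) = (e s - f s) • R) (hφ : EssBoundedBy φ M)
    (hfφ : ∀ t, (f ⋆[ContinuousLinearMap.lsmul ℂ ℂ] φ) t = 0) {l : ℝ} (hl : 0 ≤ l) (t : ℝ)
    {u : ℝ → X} (hu : u = g ⋆[ContinuousLinearMap.id ℂ (X →L[ℂ] X)] φ) :
    R (u (t + l) - u t) + ((∫ s in (0 : ℝ)..l, u (t + s)) - z • R (∫ s in (0 : ℝ)..l, u (t + s)))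
      = R ((e ⋆[ContinuousLinearMap.lsmul ℂ ℂ]
          (boxKernel l ⋆[ContinuousLinearMap.lsmul ℂ ℂ] φ)) t) := by
  set w := g' ⋆[ContinuousLinearMap.id ℂ (X →L[ℂ] X)] φ with hw
  set v := e ⋆[ContinuousLinearMap.lsmul ℂ ℂ] φ with hv
  have hconv : ∀ x, R (w x) + (u x - z • R (u x)) = R (v x) := fun x => by
    rw [hu]; exact convolution_identity hg hg' he hf h hφ hfφ x
  have huc : Continuous u := hu ▸ (uniformContinuous_convolution _ hg hφ).continuous
  have hwc : Continuous w := (uniformContinuous_convolution _ hg' hφ).continuous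
  have hvc : Continuous v := (uniformContinuous_convolution _ he hφ).continuous
  have hint : ∀ {f : ℝ → X}, Continuous f →
      IntervalIntegrable (fun s => f (t + s)) volume 0 l := fun hf =>
    (hf.comp (continuous_const.add continuous_id)).intervalIntegrable _ _
  have hRint : ∀ {f : ℝ → X}, Continuous f →
      R (∫ s in (0 : ℝ)..l, f (t + s)) = ∫ s in (0 : ℝ)..l, R (f (t + s)) := fun hf =>
    (R.intervalIntegral_comp_comm (hint hf)).symm
  have hRw : Continuous fun s => R (w s) := R.continuous.comp hwc
  have hRu : Continuous fun s => z • R (u s) := (R.continuous.comp huc).const_smul z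
  have hsub : Continuous fun s => u s - z • R (u s) := huc.sub hRu
  have e1 : u (t + l) - u t = ∫ s in (0 : ℝ)..l, w (t + s) := by
    rw [← boxKernel_convolution hl, hu, hw]
    exact (boxKernel_convolution_deriv hg hg' hgc hd hφ hl t).symm
  have e2 : (e ⋆[ContinuousLinearMap.lsmul ℂ ℂ]
      (boxKernel l ⋆[ContinuousLinearMap.lsmul ℂ ℂ] φ)) t = ∫ s in (0 : ℝ)..l, v (t + s) := by
    rw [← boxKernel_convolution hl, hv, ← convolution_assoc_of_essBoundedBy
        (ContinuousLinearMap.lsmul ℂ ℂ) (ContinuousLinearMap.lsmul ℂ ℂ)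
        (ContinuousLinearMap.lsmul ℂ ℂ) (ContinuousLinearMap.lsmul ℂ ℂ)
        (fun x y z => mul_smul x y z) he (integrable_boxKernel l) hφ,
      ← convolution_assoc_of_essBoundedBy
        (ContinuousLinearMap.lsmul ℂ ℂ) (ContinuousLinearMap.lsmul ℂ ℂ)
        (ContinuousLinearMap.lsmul ℂ ℂ) (ContinuousLinearMap.lsmul ℂ ℂ)
        (fun x y z => mul_smul x y z) (integrable_boxKernel l) he hφ, scalar_convolution_comm]
  rw [e1, e2, hRint hwc, hRint huc, hRint hvc, ← intervalIntegral.integral_smul,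
    ← intervalIntegral.integral_sub (hint huc) (hint hRu),
    ← intervalIntegral.integral_add (hint hRw) (hint hsub)]
  simp_rw [← hconv]

/-- The regularized equation for the truncated kernels. -/
theorem cutoff_equation {z : ℂ} {R : X →L[ℂ] X} (hR : IsResolventAt A z R) {χ η : ℝ → ℂ}
    (hχ : ContDiff ℝ ∞ χ) (hχ1 : ∀ x, |x| ≤ 1 → χ x = 1) (hχ2 : ∀ x, 2 ≤ |x| → χ x = 0)
    (hη : ContDiff ℝ ∞ η) (hηs : HasCompactSupport η)
    (hη1 : ∀ s ∉ axisRegular A, η =ᶠ[𝓝 s] fun _ => 1) {b ρ : ℝ} (hb : 0 < b) (hbρ : b ≤ ρ)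
    (hbU : ∀ s, b ≤ |s| → s ∈ axisRegular A) (hφ : EssBoundedBy φ M)
    (hηφ : ∀ t, (𝓕⁻ η ⋆[ContinuousLinearMap.lsmul ℂ ℂ] φ) t = 0) {l : ℝ} (hl : 0 ≤ l) (t : ℝ)
    {u : ℝ → X} (hu : u = 𝓕⁻ (cutoffResolvent A χ η ρ) ⋆[ContinuousLinearMap.id ℂ (X →L[ℂ] X)] φ) :
    R (u (t + l) - u t) + ((∫ s in (0 : ℝ)..l, u (t + s)) - z • R (∫ s in (0 : ℝ)..l, u (t + s)))
      = R ((𝓕⁻ (fun s => χ (s / ρ)) ⋆[ContinuousLinearMap.lsmul ℂ ℂ]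
          (boxKernel l ⋆[ContinuousLinearMap.lsmul ℂ ℂ] φ)) t) := by
  have hρ : 0 < ρ := hb.trans_le hbρ
  have hHd : ContDiff ℝ 2 (cutoffResolvent A χ η ρ) :=
    contDiff_cutoffResolvent hχ hχ1 hη hη1 hb hbρ hbU
  have hHs : HasCompactSupport (cutoffResolvent A χ η ρ) :=
    hasCompactSupport_cutoffResolvent hχ2 hηs hρ
  have hHd' := contDiff_two_pi_I_smul hHd
  have hHs' := hasCompactSupport_two_pi_I_smul hHs
  have hχρ := contDiff_comp_div hχ ρ
  have hχρs := hasCompactSupport_comp_div hχ2 hρ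
  have iH' := integrable_of_contDiff hHd' hHs'
  exact regularized_equation (integrable_fourierInv hHd hHs) (integrable_fourierInv hHd' hHs')
    (integrable_fourierInv hχρ hχρs) (integrable_fourierInv (hη.of_le two_le_infty) hηs)
    (continuous_fourierInv iH') (fun s => hasDerivAt_fourierInv hHd.continuous hHs s)
    (fourierInv_cutoffResolvent_identity (integrable_of_contDiff hHd hHs) iH'
      (integrable_of_contDiff hχρ hχρs) (integrable_of_contDiff hη hηs)
      (cutoffResolvent_identity hR hχ1 (fun s hs => (hη1 s hs).self_of_nhds) hρ
        fun s hs => hbU s (hbρ.trans hs))) hφ hηφ hl t hu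

/-- Convolution with the limit kernel yields mild solutions. -/
theorem isMildSolution_convolution {z : ℂ} {R : X →L[ℂ] X} (hR : IsResolventAt A z R)
    {χ η : ℝ → ℂ}
    (hχ : ContDiff ℝ ∞ χ) (hχ1 : ∀ x, |x| ≤ 1 → χ x = 1) (hχ2 : ∀ x, 2 ≤ |x| → χ x = 0)
    (hη : ContDiff ℝ ∞ η) (hηs : HasCompactSupport η)
    (hη1 : ∀ s ∉ axisRegular A, η =ᶠ[𝓝 s] fun _ => 1) {b : ℝ} (hb : 0 < b)
    (hbU : ∀ s, b ≤ |s| → s ∈ axisRegular A) {G : ℝ → X →L[ℂ] X} (hG : Integrable G)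
    (hGlim : Tendsto (fun n : ℕ => ∫ t, ‖𝓕⁻ (cutoffResolvent A χ η (b * 2 ^ n)) t - G t‖) atTop
        (𝓝 0)) (hφ : EssBoundedBy φ M)
    (hηφ : ∀ t, (𝓕⁻ η ⋆[ContinuousLinearMap.lsmul ℂ ℂ] φ) t = 0) :
    IsMildSolution A φ (G ⋆[ContinuousLinearMap.id ℂ (X →L[ℂ] X)] φ) := by
  set u := G ⋆[ContinuousLinearMap.id ℂ (X →L[ℂ] X)] φ with hu
  have huc : Continuous u := (uniformContinuous_convolution _ hG hφ).continuous
  have hbρ : ∀ n : ℕ, b ≤ b * 2 ^ n := fun n =>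
    le_mul_of_one_le_right hb.le (one_le_pow₀ one_le_two)
  let g : ℕ → ℝ → X →L[ℂ] X := fun n => 𝓕⁻ (cutoffResolvent A χ η (b * 2 ^ n))
  have hg : ∀ n, Integrable (g n) := fun n => integrable_fourierInv
    (contDiff_cutoffResolvent hχ hχ1 hη hη1 hb (hbρ n) hbU)
    (hasCompactSupport_cutoffResolvent hχ2 hηs (hb.trans_le (hbρ n)))
  let un : ℕ → ℝ → X := fun n => g n ⋆[ContinuousLinearMap.id ℂ (X →L[ℂ] X)] φ
  have hunc : ∀ n, Continuous (un n) := fun n =>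
    (uniformContinuous_convolution _ (hg n) hφ).continuous
  let d : ℕ → ℝ := fun n => ‖ContinuousLinearMap.id ℂ (X →L[ℂ] X)‖ * M * ∫ t, ‖g n t - G t‖
  have hd : Tendsto d atTop (𝓝 0) := by
    simpa using hGlim.const_mul (‖ContinuousLinearMap.id ℂ (X →L[ℂ] X)‖ * M)
  -- L¹ convergence of the kernels makes `un` converge to `u` uniformly on the line, which also
  -- carries the integrals to the limit.
  have hund : ∀ n t, ‖un n t - u t‖ ≤ d n := fun n t => by
    have := norm_convolution_le (ContinuousLinearMap.id ℂ (X →L[ℂ] X)) ((hg n).sub hG) hφ t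
    rw [← convolution_sub_left _ (hg n) hG hφ]
    exact this
  have hlim : ∀ t, Tendsto (fun n => un n t) atTop (𝓝 (u t)) := fun t =>
    tendsto_iff_norm_sub_tendsto_zero.2
      (squeeze_zero (fun n => norm_nonneg _) (fun n => hund n t) hd)
  refine hR.isMildSolution_of_translate huc fun t l hl => ?_
  have hint : ∀ {f : ℝ → X}, Continuous f →
      IntervalIntegrable (fun s => f (t + s)) volume 0 l := fun hf =>
    (hf.comp (continuous_const.add continuous_id)).intervalIntegrable _ _
  have hlimI : Tendsto (fun n => ∫ s in (0 : ℝ)..l, un n (t + s)) atTop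
      (𝓝 (∫ s in (0 : ℝ)..l, u (t + s))) := by
    refine tendsto_iff_norm_sub_tendsto_zero.2 (squeeze_zero (fun n => norm_nonneg _)
      (g := fun n => d n * |l - 0|) (fun n => ?_) (by simpa using hd.mul_const |l - 0|))
    rw [← intervalIntegral.integral_sub (hint (hunc n)) (hint huc)]
    exact intervalIntegral.norm_integral_le_of_norm_le_const fun s _ => hund n _
  have hLHS : Tendsto (fun n => R (un n (t + l) - un n t) + ((∫ s in (0 : ℝ)..l, un n (t + s))
      - z • R (∫ s in (0 : ℝ)..l, un n (t + s)))) atTop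
      (𝓝 (R (u (t + l) - u t) + ((∫ s in (0 : ℝ)..l, u (t + s))
      - z • R (∫ s in (0 : ℝ)..l, u (t + s))))) :=
    ((R.continuous.tendsto _).comp ((hlim _).sub (hlim _))).add
      (hlimI.sub (((R.continuous.tendsto _).comp hlimI).const_smul z))
  have hbox := essBoundedBy_convolution (ContinuousLinearMap.lsmul ℂ ℂ)
    (integrable_boxKernel l) hφ
  -- `φ` may be discontinuous, but its box average is continuous and bounded, so the approximate
  -- identity converges at every point; the limit factor is `χ 0 = 1`.
  have hRHS := (R.continuous.tendsto _).comp (tendsto_fourierInv_convolution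
    (hχ.of_le two_le_infty) (hasCompactSupport_of_abs fun x hx => hχ2 x hx.le)
    (uniformContinuous_convolution (ContinuousLinearMap.lsmul ℂ ℂ)
      (integrable_boxKernel l) hφ).continuous
    (norm_convolution_le (ContinuousLinearMap.lsmul ℂ ℂ) (integrable_boxKernel l) hφ)
    (c := fun n : ℕ => b * 2 ^ n) (fun n => by positivity)
    ((tendsto_pow_atTop_atTop_of_one_lt one_lt_two).const_mul_atTop hb) t)
  rw [hχ1 0 (by simp), one_smul, boxKernel_convolution hl] at hRHS
  refine tendsto_nhds_unique hLHS (hRHS.congr fun n => ?_)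
  exact (cutoff_equation hR hχ hχ1 hχ2 hη hηs hη1 hb (hbρ n) hbU hφ hηφ hl t rfl).symm

/-- A smooth cutoff around the spectrum whose support avoids `F`. -/
theorem exists_cutoff (A : X →ₗ.[ℂ] X) {b : ℝ} (hbU : ∀ s, b ≤ |s| → s ∈ axisRegular A)
    {F : Set ℝ} (hF : IsClosed F) (hFK : F ⊆ (imaginarySpectrum A)ᶜ) :
    ∃ η : ℝ → ℂ, ContDiff ℝ ∞ η ∧ HasCompactSupport η ∧
      (∀ s ∉ axisRegular A, η =ᶠ[𝓝 s] fun _ => 1) ∧ ∀ s ∈ tsupport η, 2 * Real.pi * s ∉ F := by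
  -- Including `|s| ≥ b` in the zero set of `η` forces compact support.
  let S : Set ℝ := {s | 2 * Real.pi * s ∈ F} ∪ {s | b ≤ |s|}
  have hS : IsClosed S :=
    (hF.preimage (f := fun s : ℝ => 2 * Real.pi * s) (by fun_prop)).union
      (isClosed_le continuous_const continuous_abs)
  have hdisj : Disjoint S (axisRegular A)ᶜ := by
    rw [disjoint_compl_right_iff_subset]
    rintro s (hs | hs)
    · exact hFK hs
    · exact hbU s hs
  obtain ⟨f, hf0, hf1, -⟩ := exists_contMDiffMap_zero_one_nhds_of_isClosed (n := (⊤ : ℕ∞)) 𝓘(ℝ, ℝ) hS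
    (isOpen_axisRegular A).isClosed_compl hdisj
  have htS : ∀ s ∈ tsupport (fun x => (f x : ℂ)), s ∉ S := by
    intro s hs hsS
    rw [← notMem_compl_iff] at hs
    refine hs ((notMem_tsupport_iff_eventuallyEq).2 ?_)
    filter_upwards [eventually_nhdsSet_iff_forall.1 hf0 s hsS] with x hx
    simp [hx]
  refine ⟨fun x => (f x : ℂ), Complex.ofRealCLM.contDiff.comp f.contMDiff.contDiff, ?_, ?_, ?_⟩
  · refine hasCompactSupport_of_abs (ρ := b) fun s hs => ?_
    by_contra h
    exact htS s (subset_tsupport _ h) (Or.inr hs.le)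
  · intro s hs
    filter_upwards [eventually_nhdsSet_iff_forall.1 hf1 s hs] with x hx
    simp [hx]
  · exact fun s hs hsF => htS s hs (Or.inl hsF)

end MildSolution
end NonResonance

/-! ### Rescaled resolvent bound and the main theorem. -/

namespace NonResonance

/-- For `|t| ≥ a` the exponent may be lowered to `min θ 1` at the price of a power of `a`. It still
exceeds 1/2, and being at most 1 it makes the bound compatible with `ρ⁻¹ ≤ m` in the dyadic
estimate. -/
theorem norm_axisResolvent_le {X : Type*} [NormedAddCommGroup X] [NormedSpace ℂ X]
    {A : X →ₗ.[ℂ] X} {a θ C : ℝ} (ha : 0 < a)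
    (hC : ∀ t : ℝ, t ∉ Ioo (-a) a → |t| ^ θ * ‖unboundedResolvent A (Complex.I * t)‖ ≤ C) {s : ℝ}
    (hs : a / (2 * Real.pi) ≤ |s|) :
    ‖axisResolvent A s‖ ≤
      C * a ^ (min θ 1 - θ) * (2 * Real.pi) ^ (-min θ 1) * |s| ^ (-min θ 1) := by
  have hpi : 0 < 2 * Real.pi := by positivity
  have habs : |2 * Real.pi * s| = 2 * Real.pi * |s| := by rw [abs_mul, abs_of_pos hpi]
  have hat : a ≤ |2 * Real.pi * s| := by
    rw [habs]
    rwa [div_le_iff₀ hpi, mul_comm] at hs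
  have ht0 : 0 < |2 * Real.pi * s| := ha.trans_le hat
  have h1 := hC (2 * Real.pi * s) fun h => (abs_lt.2 h).not_ge hat
  have hC0 : 0 ≤ C := le_trans (by positivity) h1
  change |2 * Real.pi * s| ^ θ * ‖axisResolvent A s‖ ≤ C at h1
  rw [mul_assoc _ ((2 * Real.pi) ^ (-min θ 1)), ← Real.mul_rpow hpi.le (abs_nonneg s), ← habs]
  have h2 : |2 * Real.pi * s| ^ (-θ)
      ≤ a ^ (min θ 1 - θ) * |2 * Real.pi * s| ^ (-min θ 1) := by
    calc _ = |2 * Real.pi * s| ^ (min θ 1 - θ) * |2 * Real.pi * s| ^ (-min θ 1) := by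
          rw [← Real.rpow_add ht0]; congr 1; ring
      _ ≤ _ := mul_le_mul_of_nonneg_right
          (Real.rpow_le_rpow_of_nonpos ha hat (by linarith [min_le_left θ 1]))
          (Real.rpow_pos_of_pos ht0 _).le
  calc ‖axisResolvent A s‖ ≤ C * |2 * Real.pi * s| ^ (-θ) := by
        rw [Real.rpow_neg ht0.le, ← div_eq_mul_inv, le_div_iff₀ (Real.rpow_pos_of_pos ht0 _),
          mul_comm]
        exact h1
    _ ≤ C * (a ^ (min θ 1 - θ) * |2 * Real.pi * s| ^ (-min θ 1)) := by gcongr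
    _ = _ := by ring

end NonResonance

theorem theorem6p3 {X : Type*} [NormedAddCommGroup X] [NormedSpace ℂ X] [CompleteSpace X]
    (T : C0Semigroup X) (a : ℝ) (ha : 0 < a)
    (hK : imaginarySpectrum T.generator ⊆ Ioo (-a) a)
    (θ : ℝ) (hθ : 1 / 2 < θ)
    (hR : ∃ C : ℝ, ∀ t : ℝ, t ∉ Ioo (-a) a →
      |t| ^ θ * ‖unboundedResolvent T.generator (Complex.I * t)‖ ≤ C)
    (F : Set ℝ) (hF : IsClosed F) (hFK : F ⊆ (imaginarySpectrum T.generator)ᶜ) :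
    ∃ G : ℝ → X →L[ℂ] X, Integrable G ∧
      ∀ φ : ℝ → X, MemLp φ ∞ → beurlingSpectrum φ ⊆ F →
      ∀ J : Set ℝ, (J = univ ∨ J = Ici 0) →
      ∀ 𝓕 : Submodule ℂ (J → X), IsInvariantClass 𝓕 →
        J.domRestrict φ ∈ meanClass (𝓕 : Set (J → X)) →
          (∀ t : ℝ, Integrable (fun s => G s (φ (t - s)))) ∧
          IsMildSolution T.generator φ (opConvolution G φ) ∧
          IsBUC (opConvolution G φ) ∧
          J.domRestrict (opConvolution G φ) ∈ 𝓕 := by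
  have hpi : 0 < 2 * Real.pi := by positivity
  have hb : 0 < a / (2 * Real.pi) := by positivity
  have hbU : ∀ s, a / (2 * Real.pi) ≤ |s| → s ∈ axisRegular T.generator := by
    intro s hs hsK
    have h := abs_lt.2 (hK hsK)
    rw [abs_mul, abs_of_pos hpi] at h
    rw [div_le_iff₀ hpi, mul_comm] at hs
    exact h.not_ge hs
  obtain ⟨C, hC⟩ := hR
  obtain ⟨χ, hχ, hχ1, hχ2⟩ := exists_contDiff_bump
  obtain ⟨η, hη, hηs, hη1, hηF⟩ := exists_cutoff T.generator hbU hF hFK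
  obtain ⟨G, hG, hGlim⟩ := exists_kernel hχ hχ1 hχ2 hη hηs hη1 hb hbU
    (lt_min hθ (by norm_num)) (min_le_right θ 1) fun s hs => norm_axisResolvent_le ha hC hs
  refine ⟨G, hG, fun φ hφ hsp J hJ 𝓕 h𝓕 hφ𝓕 => ?_⟩
  obtain ⟨M, hM⟩ := MemLp.exists_essBoundedBy hφ
  -- One reference resolvent suffices; it is taken at `s = a/(2π)`, that is `z = ia`.
  have hR := isResolventAt_unboundedResolvent (A := T.generator) (hbU _ (le_abs_self _))
  exact ⟨convolutionExistsAt_of_essBoundedBy (ContinuousLinearMap.id ℂ (X →L[ℂ] X)) hG hM,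
    isMildSolution_convolution hR hχ hχ1 hχ2 hη hηs hη1 hb hbU hG hGlim hM
      fun t => fourierInv_convolution_eq_zero hM hη hηs (fun s hs h => hηF s hs (hsp h)) t,
    isBUC_convolution (ContinuousLinearMap.id ℂ (X →L[ℂ] X)) hG hM,
    h𝓕.convolution_mem_of_mem_meanClass hJ hM hφ𝓕 hG⟩
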